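/- Let $X$ be a standard Borel space, let $E$ be a Borel equivalence relation on $X$ all of whose classes are countable, let $\rho\colon E\to(0,\infty)$ be a Borel cocycle (that is, a Borel function with $\rho(x,z)=\rho(x,y)\rho(y,z)$ whenever $x\mathrel{E}y\mathrel{E}z$), and let $A\subseteq X$ be a Borel set that meets every $E$-class. Then there are $E$-invariant Borel sets $B,C,D\subseteq X$ with $X=B\cup C\cup D$ such that: 1. the cocycle $\rho|(E|B)$ is smooth; 2. $A\cap C$ has $\sigma$-positive $\rho|(E|C)$-density; 3. there are a finite Borel subequivalence relation $F$ of $E|D$ and a finite-to-one Borel compression of the quotient $(\rho|(E|D))/F$. Here $E|Y=E\cap(Y\times Y)$, a set is $E$-invariant if it is a union of $E$-classes, and a subequivalence relation is finite if all its classes are finite. The remaining notions are defined as follows for an arbitrary Borel cocycle $\rho\colon E\to(0,\infty)$ on a countable Borel equivalence relation $E$ on a standard Borel space $X$. - For a subset $Y$ of the $E$-class of $z$, put $|Y|^\rho_z=\sum_{y\in Y}\rho(y,z)\in[0,\infty]$. For subsets $Y,Z$ of one $E$-class with $Z$ finite and non-empty, put $|Y|^\rho_Z=|Y|^\rho_z/|Z|^\rho_z$,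 where $z$ is any point of that class (the value does not depend on $z$). - $\rho$ is smooth if there are an open neighborhood $U\subseteq(0,\infty)$ of $1$ and a Borel function $c\colon X\to\mathbb N$ such that $c(x)\neq c(y)$ whenever $x\neq y$, $x\mathrel{E}y$ and $\rho(x,y)\in U$. - A Borel set $S\subseteq X$ has positive $\rho$-density if there are $\epsilon>0$ and a finite Borel subequivalence relation $F$ of $E$ with $|S\cap[x]_F|^\rho_{[x]_F}\ge\epsilon$ for all $x\in X$. It has $\sigma$-positive $\rho$-density if $X$ is the union of countably many $E$-invariant Borel sets $A_n$ such that $A_n\cap S$ has positive $\rho|(E|A_n)$-density for each $n$. - For a finite Borel subequivalence relation $F$ of $E$, the quotient $\rho/F\colon E/F\to(0,\infty)$ is the cocycle on the equivalence relation $E/F$ induced by $E$ on $X/F$ (with the quotient Borel structure) that is given by $(\rho/F)([x]_F,[y]_F)=|[x]_F|^\rho_{[y]_F}$. - A compression of $\rho$ is a function $\phi\colon X\to X$ such that $x\mathrel{E}\phi(x)$ and $|\phi^{-1}(x)|^\rho_x\le1$ for all $x\in X$, and such that the set $\{x\in X : |\phi^{-1}(x)|^\rho_x<1\}$ meets every $E$-class.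 It is finite-to-one if all the sets $\phi^{-1}(x)$ are finite. -/

import Mathlib

open scoped ENNReal

namespace BorelCocycle

noncomputable section

variable {X : Type*}

/-- The equivalence relation `E` is Borel, as a subset of `X × X`. -/
def IsBorelRel [MeasurableSpace X] (E : Setoid X) : Prop :=
  MeasurableSet {p : X × X | E p.1 p.2}

/-- Every equivalence class is countable. -/
def IsCountableRel (E : Setoid X) : Prop := ∀ x, {y | E y x}.Countable

/-- Every equivalence class is finite. -/
def IsFiniteRel (E : Setoid X) : Prop := ∀ x, {y | E y x}.Finite

/-- `F` is a finite Borel subequivalence relation of `E`. -/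
structure IsFiniteBorelSub [MeasurableSpace X] (F E : Setoid X) : Prop where
  le : F ≤ E
  finite : IsFiniteRel F
  borel : IsBorelRel F

/-- `Y` intersects every `E`-class. -/
def IsComplete (E : Setoid X) (Y : Set X) : Prop := ∀ x, ∃ y ∈ Y, E y x

/-- `Y` is a union of `E`-classes. -/
def IsInvariant (E : Setoid X) (Y : Set X) : Prop := ∀ x y, E x y → x ∈ Y → y ∈ Y

/-- `ρ` is a Borel cocycle `E → (0, ∞)`. It is written as a function on `X × X`, but its values
off `E` are arbitrary and are never used: positivity, Borel measurability (of the restriction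
of `ρ` to `E`) and the cocycle identity are required on `E` only. -/
structure IsBorelCocycle [MeasurableSpace X] (E : Setoid X) (ρ : X → X → ℝ) : Prop where
  pos : ∀ x y, E x y → 0 < ρ x y
  mul : ∀ x y z, E x y → E y z → ρ x z = ρ x y * ρ y z
  borel : Measurable fun p : {p : X × X // E p.1 p.2} => ρ p.1.1 p.1.2

/-- The restriction of `E` to `B`. -/
def restrictRel (E : Setoid X) (B : Set X) : Setoid B := E.comap Subtype.val

/-- The restriction of `ρ` to the restriction of `E` to `B`. -/
def restrictCocycle (ρ : X → X → ℝ) (B : Set X) : B → B → ℝ := fun x y => ρ x y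

/-- The `ρ`-size of `Y` relative to the point `z`, where `Y` is contained in the class of `z`. -/
def size (ρ : X → X → ℝ) (z : X) (Y : Set X) : ℝ≥0∞ := ∑' y : Y, ENNReal.ofReal (ρ y z)

/-- The `ρ`-size of `Y` relative to the nonempty set `Z`, where `Y` and `Z` are contained in the
class of `z`. It does not depend on the choice of `z` in that class. -/
def relSize (ρ : X → X → ℝ) (z : X) (Y Z : Set X) : ℝ≥0∞ := size ρ z Y / size ρ z Z

/-- The digraph relating distinct `E`-equivalent points `x`, `y` for which `ρ x y ∈ Z`. -/
def lacunarityGraph (E : Setoid X) (ρ : X → X → ℝ) (Z : Set ℝ) : Digraph X where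
  Adj x y := x ≠ y ∧ E x y ∧ ρ x y ∈ Z

/-- `c` is a coloring of the digraph `G`: each of its fibers is `G`-independent. -/
def IsColoring {Y : Type*} (G : Digraph X) (c : X → Y) : Prop := ∀ x y, G.Adj x y → c x ≠ c y

/-- `ρ` is smooth: for some open neighborhood `U ⊆ (0, ∞)` of `1` there is a Borel
`ℕ`-coloring of the associated digraph. -/
def IsSmooth [MeasurableSpace X] (E : Setoid X) (ρ : X → X → ℝ) : Prop :=
  ∃ U : Set ℝ, IsOpen U ∧ U ⊆ Set.Ioi 0 ∧ (1 : ℝ) ∈ U ∧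
    ∃ c : X → ℕ, Measurable c ∧ IsColoring (lacunarityGraph E ρ U) c

/-- `φ` is a compression of `ρ`. -/
structure IsCompression (E : Setoid X) (ρ : X → X → ℝ) (φ : X → X) : Prop where
  graph : ∀ x, E x (φ x)
  le_one : ∀ x, size ρ x (φ ⁻¹' {x}) ≤ 1
  complete : IsComplete E {x | size ρ x (φ ⁻¹' {x}) < 1}

/-- The fibers of `φ` are finite. -/
def IsFiniteToOne (φ : X → X) : Prop := ∀ x, (φ ⁻¹' {x}).Finite

/-- The equivalence relation `E / F` on `X / F`, for `F ≤ E`: the classes of `x` and `y` are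
related if and only if `E x y`. -/
def quotientRel (E F : Setoid X) (h : F ≤ E) : Setoid (Quotient F) :=
  Setoid.ker (Quotient.map' (s₁ := F) (s₂ := E) id h)

/-- The `F`-class of `X` corresponding to a point of the quotient. -/
def toClass (F : Setoid X) (a : Quotient F) : Set X := {x | Quotient.mk F x = a}

/-- The quotient of `ρ` by `F`: its value at a pair `(a, b)` of `E`-related `F`-classes is the
`ρ`-size of `a` relative to `b`. -/
def quotientCocycle (F : Setoid X) (ρ : X → X → ℝ) (a b : Quotient F) : ℝ :=
  (relSize ρ b.out (toClass F a) (toClass F b)).toReal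

/-- There is a finite-to-one Borel compression of the quotient of `ρ` by a finite Borel
subequivalence relation of `E`. The quotient carries the quotient Borel structure. -/
def HasFiniteToOneQuotientCompression [MeasurableSpace X] (E : Setoid X) (ρ : X → X → ℝ) : Prop :=
  ∃ (F : Setoid X) (hF : IsFiniteBorelSub F E) (φ : Quotient F → Quotient F),
    Measurable φ ∧ IsFiniteToOne φ ∧
      IsCompression (quotientRel E F hF.le) (quotientCocycle F ρ) φ

/-- `B` has `ρ`-density at least `ε`. -/
def HasDensityAtLeast [MeasurableSpace X] (E : Setoid X) (ρ : X → X → ℝ) (B : Set X) (ε : ℝ) :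
    Prop :=
  ∃ F : Setoid X, IsFiniteBorelSub F E ∧
    ∀ x, ENNReal.ofReal ε ≤ relSize ρ x (B ∩ {y | F y x}) {y | F y x}

/-- `B` has positive `ρ`-density. -/
def HasPositiveDensity [MeasurableSpace X] (E : Setoid X) (ρ : X → X → ℝ) (B : Set X) : Prop :=
  ∃ ε : ℝ, 0 < ε ∧ HasDensityAtLeast E ρ B ε

/-- `B` has `σ`-positive `ρ`-density. -/
def HasSigmaPositiveDensity [MeasurableSpace X] (E : Setoid X) (ρ : X → X → ℝ) (B : Set X) :
    Prop :=
  ∃ A : ℕ → Set X, (∀ n, MeasurableSet (A n) ∧ IsInvariant E (A n)) ∧ ⋃ n, A n = Set.univ ∧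
    ∀ n, HasPositiveDensity (restrictRel E (A n)) (restrictCocycle ρ (A n))
      (Subtype.val ⁻¹' B : Set (A n))

end

end BorelCocycle

/-! The three sets come from one exhaustion. Start with `A 0 = A` and with equality as `F 0`. At
each stage take a maximal disjoint Borel family of finite sets `T`, each a union of `F n`-classes
and balanced: |T ∩ A n| ≤ |T \ A n| ≤ 3 |T ∩ A n|. Let `A (n + 1)` be the union of the family; let
its members be the `F (n + 1)`-classes inside `A (n + 1)`, and keep `F n` outside. The second
inequality means that the density of `A` drops by a factor of at most 4 per stage. The first leaves
room to push `T ∩ A n` into `T \ A n`.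

Suppose that an `E`-class has points of `A n` as well as points off `A n` outside `A (n + 1)`. If on
each side some leftover point saw infinitely many leftover `F n`-classes of size comparable to its
own, a further balanced set could be assembled (`exists_isBalanced`), against maximality. So some
leftover point sees only finitely many, and classes with such points are covered by countably many
lacunary Borel sets (`Generates.countablyLacunary_saturation`); they form `B`. On every other class
and for every `n`, either `A n ∪ A (n + 1)` is the whole class or `A n ⊆ A (n + 1)` there. If the
first happens for some `n`, then `F (n + 1)` witnesses density at least `4⁻¹ ^ (n + 1)`; this gives
`C`. On the remaining set `D` the `A n` increase. Cut each `F n` down to the points that enter at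
time `n` and map each resulting class into the next level within its `F (n + 1)`-class: fibers are
no larger than their targets, and the classes in `A 0` have empty fibers.

The Borel side rests on the Lusin–Novikov and Feldman–Moore theorems. They turn quantifiers and sums
over classes into countable ones and yield maximal Borel families of finite sets
(`Generates.exists_maximal_family`). -/

namespace LusinNovikov

/-! ### The Lusin–Novikov theorem. -/

open MeasureTheory Set Filter Topology

variable {Z X : Type*}

/-- An analytic set on which a continuous map is injective is contained in a Borel set on which
the map is injective. -/
theorem exists_measurable_injOn_of_analytic [TopologicalSpace Z] [PolishSpace Z]
    [MeasurableSpace Z] [BorelSpace Z] [TopologicalSpace X] [PolishSpace X]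
    [MeasurableSpace X] [BorelSpace X] {p : Z → X} (hp : Continuous p) {A : Set Z}
    (hA : AnalyticSet A) (hinj : InjOn p A) :
    ∃ B, A ⊆ B ∧ MeasurableSet B ∧ InjOn p B := by
  let b := TopologicalSpace.countableBasis Z
  have hb := TopologicalSpace.isBasis_countableBasis Z
  have hcount : Countable b := TopologicalSpace.countable_countableBasis Z
  -- Injectivity makes the images of disjoint pieces of `A` disjoint analytic sets, so they can be
  -- separated by a Borel set. The Borel set used below admits a point of `u` only if its image is
  -- in `W u v` and a point of `v` only if its image is not.
  have hsep : ∀ u v : b, ∃ W : Set X, MeasurableSet W ∧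
      (Disjoint (u : Set Z) v → p '' (A ∩ u) ⊆ W ∧ Disjoint (p '' (A ∩ v)) W) := by
    intro u v
    by_cases huv : Disjoint (u : Set Z) v
    · have key : ∀ w : b, AnalyticSet (p '' (A ∩ w)) := by
        intro w
        have hw : AnalyticSet (w : Set Z) := (hb.isOpen w.2).measurableSet.analyticSet
        refine AnalyticSet.image_of_continuous ?_ hp
        rw [inter_eq_iInter]
        exact AnalyticSet.iInter (by rintro (_ | _) <;> assumption)
      have hdisj : Disjoint (p '' (A ∩ u)) (p '' (A ∩ v)) := by
        rw [disjoint_left]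
        rintro _ ⟨x, ⟨hxA, hxu⟩, rfl⟩ ⟨y, ⟨hyA, hyv⟩, hxy⟩
        have := hinj hyA hxA hxy
        subst this
        exact disjoint_left.1 huv hxu hyv
      obtain ⟨W, h1, h2, h3⟩ := (key u).measurablySeparable (key v) hdisj
      exact ⟨W, h3, fun _ => ⟨h1, h2⟩⟩
    · exact ⟨∅, .empty, fun h => absurd h huv⟩
  choose W hWm hW using hsep
  refine ⟨⋂ u : b, ⋂ v : b, ⋂ _ : Disjoint (u : Set Z) v,
    ((u : Set Z)ᶜ ∪ p ⁻¹' (W u v)) ∩ ((v : Set Z)ᶜ ∪ (p ⁻¹' (W u v))ᶜ), ?_, ?_, ?_⟩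
  · intro x hx
    simp only [mem_iInter]
    intro u v huv
    refine ⟨?_, ?_⟩
    · by_cases hu : x ∈ (u : Set Z)
      · exact .inr ((hW u v huv).1 ⟨x, ⟨hx, hu⟩, rfl⟩)
      · exact .inl hu
    · by_cases hv : x ∈ (v : Set Z)
      · exact .inr (disjoint_left.1 (hW u v huv).2 ⟨x, ⟨hx, hv⟩, rfl⟩)
      · exact .inl hv
  · refine .iInter fun u => .iInter fun v => .iInter fun _ => ?_
    exact ((hb.isOpen u.2).measurableSet.compl.union (hp.measurable (hWm u v))).inter
      ((hb.isOpen v.2).measurableSet.compl.union (hp.measurable (hWm u v)).compl)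
  · intro x hx y hy hxy
    by_contra hne
    obtain ⟨U, V, hU, hV, hxU, hyV, hUV⟩ := t2_separation hne
    obtain ⟨u, hu, hxu, huU⟩ := hb.exists_subset_of_mem_open hxU hU
    obtain ⟨v, hv, hyv, hvV⟩ := hb.exists_subset_of_mem_open hyV hV
    have huv : Disjoint u v := hUV.mono huU hvV
    simp only [mem_iInter] at hx hy
    have h1 := (hx ⟨u, hu⟩ ⟨v, hv⟩ huv).1
    have h2 := (hy ⟨u, hu⟩ ⟨v, hv⟩ huv).2
    simp only [mem_union, mem_compl_iff, mem_preimage, hxu, hyv, not_true, false_or] at h1 h2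
    rw [hxy] at h1
    exact h2 h1

/-- Points over which every one of the sets `b i`, `i ∈ a`, has an element of `Y`. -/
def common (p : Z → X) (b : ℕ → Set Z) (a : Finset ℕ) (Y : Set Z) : Set X :=
  {x | ∀ i ∈ a, ∃ z ∈ b i ∩ Y, p z = x}

/-- `b j` and `b k` are small sets with disjoint closures contained in `b i`. -/
def Splits [PseudoMetricSpace Z] (b : ℕ → Set Z) (n i j k : ℕ) : Prop :=
  (∀ l, l = j ∨ l = k → closure (b l) ⊆ b i ∧ Metric.ediam (b l) ≤ ((n : ℝ≥0∞) + 1)⁻¹) ∧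
    Disjoint (b j) (b k)

/-- No splitting of `b i` leads to a nonempty set of common points. -/
def Terminal [PseudoMetricSpace Z] (p : Z → X) (b : ℕ → Set Z) (Y : Set Z) (a : Finset ℕ)
    (n i : ℕ) : Prop :=
  ∀ j k, Splits b n i j k → common p b (insert j (insert k a)) Y = ∅

/-- The set is covered by countably many Borel sets on which `p` is injective. -/
def CountablyInjective [MeasurableSpace Z] (p : Z → X) (Y : Set Z) : Prop :=
  ∃ B : ℕ → Set Z, (∀ n, MeasurableSet (B n) ∧ InjOn p (B n)) ∧ Y ⊆ ⋃ n, B n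

theorem CountablyInjective.iUnion [MeasurableSpace Z] {p : Z → X} {ι : Type*} [Countable ι]
    {Y : ι → Set Z} (h : ∀ i, CountablyInjective p (Y i)) : CountablyInjective p (⋃ i, Y i) := by
  choose B hB hY using h
  rcases isEmpty_or_nonempty (ι × ℕ) with he | he
  · refine ⟨fun _ => ∅, fun _ => ⟨.empty, injOn_empty _⟩, ?_⟩
    intro x hx
    obtain ⟨i, -⟩ := mem_iUnion.1 hx
    exact (he.false (i, 0)).elim
  · obtain ⟨e, he⟩ := exists_surjective_nat (ι × ℕ)
    refine ⟨fun n => B (e n).1 (e n).2, fun n => hB _ _, ?_⟩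
    intro x hx
    obtain ⟨i, hi⟩ := mem_iUnion.1 hx
    obtain ⟨n, hn⟩ := mem_iUnion.1 (hY i hi)
    obtain ⟨m, hm⟩ := he (i, n)
    exact mem_iUnion.2 ⟨m, by simpa [hm] using hn⟩

theorem CountablyInjective.mono [MeasurableSpace Z] {p : Z → X} {Y Y' : Set Z}
    (h : CountablyInjective p Y) (hY : Y' ⊆ Y) : CountablyInjective p Y' := by
  obtain ⟨B, hB, hYB⟩ := h
  exact ⟨B, hB, hY.trans hYB⟩

theorem countablyInjective_of_injOn [MeasurableSpace Z] {p : Z → X} {B : Set Z}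
    (hB : MeasurableSet B) (h : InjOn p B) : CountablyInjective p B :=
  ⟨fun _ => B, fun _ => ⟨hB, h⟩, fun _ hx => mem_iUnion.2 ⟨0, hx⟩⟩

theorem common_mono {p : Z → X} {b : ℕ → Set Z} {a : Finset ℕ} {Y Y' : Set Z} (h : Y' ⊆ Y) :
    common p b a Y' ⊆ common p b a Y := by
  intro x hx i hi
  obtain ⟨z, hz, hzx⟩ := hx i hi
  exact ⟨z, ⟨hz.1, h hz.2⟩, hzx⟩

theorem Terminal.mono [PseudoMetricSpace Z] {p : Z → X} {b : ℕ → Set Z} {Y Y' : Set Z}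
    {a : Finset ℕ} {n i : ℕ} (h : Terminal p b Y a n i) (hY : Y' ⊆ Y) : Terminal p b Y' a n i :=
  fun j k hjk => subset_eq_empty (common_mono hY) (h j k hjk)

theorem exists_splits [MetricSpace Z] {b : ℕ → Set Z}
    (hb : ∀ z, ∀ U, IsOpen U → z ∈ U → ∃ i, z ∈ b i ∧ b i ⊆ U)
    (hbo : ∀ i, IsOpen (b i)) {i : ℕ} (n : ℕ) {x y : Z} (hx : x ∈ b i) (hy : y ∈ b i)
    (hxy : x ≠ y) : ∃ j k, Splits b n i j k ∧ x ∈ b j ∧ y ∈ b k := by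
  obtain ⟨U, V, hU, hV, hxU, hyV, hUV⟩ := t2_separation hxy
  have key : ∀ z ∈ b i, ∀ W, IsOpen W → z ∈ W → ∃ j, z ∈ b j ∧ b j ⊆ W ∧ closure (b j) ⊆ b i ∧
      Metric.ediam (b j) ≤ ((n : ℝ≥0∞) + 1)⁻¹ := by
    intro z hz W hW hzW
    obtain ⟨ε, hε, hεb⟩ := Metric.isOpen_iff.1 ((hbo i).inter hW) z ⟨hz, hzW⟩
    have hpos : (0 : ℝ≥0∞) < ((n : ℝ≥0∞) + 1)⁻¹ / 2 := by
      apply ENNReal.div_pos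
      · simp
      · simp
    obtain ⟨j, hzj, hj⟩ := hb z (Metric.ball z (ε / 2) ∩ Metric.eball z (((n : ℝ≥0∞) + 1)⁻¹ / 2))
      (Metric.isOpen_ball.inter Metric.isOpen_eball)
      ⟨Metric.mem_ball_self (by positivity), Metric.mem_eball_self hpos⟩
    have hcl : closure (b j) ⊆ Metric.ball z ε :=
      (closure_mono (hj.trans inter_subset_left)).trans
        (Metric.closure_ball_subset_closedBall.trans (Metric.closedBall_subset_ball (by linarith)))
    refine ⟨j, hzj, ?_, hcl.trans (hεb.trans inter_subset_left), ?_⟩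
    · exact subset_closure.trans (hcl.trans (hεb.trans inter_subset_right))
    · refine (Metric.ediam_mono (hj.trans inter_subset_right)).trans
        (Metric.ediam_eball_le.trans ?_)
      rw [ENNReal.mul_div_cancel (by simp) (by simp)]
  obtain ⟨j, h1, h2, h3⟩ := key x hx U hU hxU
  obtain ⟨k, h4, h5, h6⟩ := key y hy V hV hyV
  refine ⟨j, k, ⟨?_, hUV.mono h2 h5⟩, h1, h4⟩
  rintro l (rfl | rfl) <;> assumption

/-- There is a set with negligible complement for which each terminal family is already terminal
if it is so for some smaller set of this kind. -/
theorem exists_stable [PseudoMetricSpace Z] [MeasurableSpace Z] (p : Z → X) (b : ℕ → Set Z) :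
    ∃ Y, MeasurableSet Y ∧ CountablyInjective p Yᶜ ∧ ∀ Y' ⊆ Y, MeasurableSet Y' →
      CountablyInjective p Y'ᶜ → ∀ a n i, Terminal p b Y' a n i → Terminal p b Y a n i := by
  have : ∀ q : Finset ℕ × ℕ × ℕ, ∃ Y, MeasurableSet Y ∧ CountablyInjective p Yᶜ ∧
      ∀ Y', MeasurableSet Y' → CountablyInjective p Y'ᶜ → Terminal p b Y' q.1 q.2.1 q.2.2 →
        Terminal p b Y q.1 q.2.1 q.2.2 := by
    intro q
    -- Terminality passes to smaller sets and there are countably many triples, so one witness per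
    -- triple can be fixed, where one exists, and all of them intersected.
    by_cases h : ∃ Y, MeasurableSet Y ∧ CountablyInjective p Yᶜ ∧ Terminal p b Y q.1 q.2.1 q.2.2
    · obtain ⟨Y, h1, h2, h3⟩ := h
      exact ⟨Y, h1, h2, fun _ _ _ _ => h3⟩
    · refine ⟨univ, .univ, ?_, fun Y' h1 h2 h3 => absurd ⟨Y', h1, h2, h3⟩ h⟩
      rw [compl_univ]
      exact countablyInjective_of_injOn .empty (injOn_empty _)
  choose Y h1 h2 h3 using this
  refine ⟨⋂ q, Y q, .iInter h1, ?_, ?_⟩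
  · rw [compl_iInter]
    exact CountablyInjective.iUnion h2
  · intro Y' _ hm hc a n i ht
    exact (h3 (a, n, i) Y' hm hc ht).mono (iInter_subset _ _)

section

variable [MetricSpace Z] [CompleteSpace Z] [SecondCountableTopology Z]
  [MeasurableSpace Z] [BorelSpace Z] [TopologicalSpace X] [PolishSpace X]
  [MeasurableSpace X] [BorelSpace X] {p : Z → X} {b : ℕ → Set Z}

/-- Two distinct points of this set in one fiber would be separated by a splitting of `b i`, and
their common image would contradict terminality. The set is a projection of a Borel set of tuples,
hence analytic, so `exists_measurable_injOn_of_analytic` applies. -/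
theorem exists_measurable_of_terminal (hp : Continuous p)
    (hb : ∀ z, ∀ U, IsOpen U → z ∈ U → ∃ i, z ∈ b i ∧ b i ⊆ U)
    (hbo : ∀ i, IsOpen (b i)) {Y : Set Z} (hY : MeasurableSet Y) {a : Finset ℕ} {n i : ℕ}
    (h : Terminal p b Y a n i) :
    ∃ B, b i ∩ Y ∩ p ⁻¹' common p b a Y ⊆ B ∧ MeasurableSet B ∧ InjOn p B := by
  apply exists_measurable_injOn_of_analytic hp
  · let e : Z × (a → Z) → Z := Prod.fst
    have : b i ∩ Y ∩ p ⁻¹' common p b a Y =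
        e '' ({q | q.1 ∈ b i ∩ Y} ∩ ⋂ j : a, {q | q.2 j ∈ b j ∩ Y ∧ p (q.2 j) = p q.1}) := by
      ext z
      constructor
      · rintro ⟨hz, hzc⟩
        choose f hf using fun j : a => hzc j j.2
        exact ⟨(z, f), ⟨hz, by simpa using fun j hj => hf ⟨j, hj⟩⟩, rfl⟩
      · rintro ⟨⟨z', f⟩, ⟨h1, h2⟩, rfl⟩
        refine ⟨h1, fun j hj => ?_⟩
        simp only [mem_iInter] at h2
        exact ⟨f ⟨j, hj⟩, h2 ⟨j, hj⟩⟩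
    rw [this]
    have hm : ∀ j, MeasurableSet (b j ∩ Y) := fun j => (hbo j).measurableSet.inter hY
    refine (MeasurableSet.analyticSet ?_).image_of_continuous continuous_fst
    refine (measurable_fst (hm i)).inter (.iInter fun j => ?_)
    have h1 : Measurable fun q : Z × (a → Z) => q.2 j := (measurable_pi_apply j).comp measurable_snd
    exact (h1 (hm j)).inter (measurableSet_eq_fun (hp.measurable.comp h1)
      (hp.measurable.comp measurable_fst))
  · rintro x ⟨⟨hx1, hx2⟩, hx3⟩ y ⟨⟨hy1, hy2⟩, -⟩ hxy
    by_contra hne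
    obtain ⟨j, k, hjk, hxj, hyk⟩ := exists_splits hb hbo n hx1 hy1 hne
    have := h j k hjk
    have hmem : p x ∈ common p b (insert j (insert k a)) Y := by
      intro l hl
      rcases Finset.mem_insert.1 hl with rfl | hl
      · exact ⟨x, ⟨hxj, hx2⟩, rfl⟩
      rcases Finset.mem_insert.1 hl with rfl | hl
      · exact ⟨y, ⟨hyk, hy2⟩, hxy.symm⟩
      · exact hx3 l hl
    rw [this] at hmem
    exact hmem

/-- If every splitting produced a family with a terminal member, each such member would yield a
Borel set of injectivity. Removing these countably many sets from `Y` makes `a` terminal at `i`; by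
stability it was so already for `Y`. -/
theorem exists_alive_extension (hp : Continuous p)
    (hb : ∀ z, ∀ U, IsOpen U → z ∈ U → ∃ i, z ∈ b i ∧ b i ⊆ U) (hbo : ∀ i, IsOpen (b i))
    {Y : Set Z} (hY : MeasurableSet Y) (hYc : CountablyInjective p Yᶜ)
    (hst : ∀ Y' ⊆ Y, MeasurableSet Y' →
      CountablyInjective p Y'ᶜ → ∀ a n i, Terminal p b Y' a n i → Terminal p b Y a n i)
    {a : Finset ℕ} (ha : ∀ i ∈ a, ∀ n, ¬ Terminal p b Y a n i) {i : ℕ} (hi : i ∈ a) (n : ℕ) :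
    ∃ j k, Splits b n i j k ∧
      ∀ l ∈ insert j (insert k a), ∀ m, ¬ Terminal p b Y (insert j (insert k a)) m l := by
  by_contra! hcon
  have : ∀ q : ℕ × ℕ, ∃ B, MeasurableSet B ∧ InjOn p B ∧ (Splits b n i q.1 q.2 →
      ∃ l ∈ insert q.1 (insert q.2 a), b l ∩ Y ∩
        p ⁻¹' common p b (insert q.1 (insert q.2 a)) Y ⊆ B) := by
    intro q
    by_cases hq : Splits b n i q.1 q.2
    · obtain ⟨l, hl, m, hm⟩ := hcon q.1 q.2 hq
      obtain ⟨B, h1, h2, h3⟩ := exists_measurable_of_terminal hp hb hbo hY hm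
      exact ⟨B, h2, h3, fun _ => ⟨l, hl, h1⟩⟩
    · exact ⟨∅, .empty, injOn_empty _, fun h => absurd h hq⟩
  choose B hBm hBi hB using this
  have hsub : Y \ ⋃ q, B q ⊆ Y := sdiff_subset
  refine ha i hi n (hst _ hsub (hY.diff (.iUnion hBm)) ?_ a n i ?_)
  · have : (Y \ ⋃ q, B q)ᶜ = ⋃ c : Bool, cond c Yᶜ (⋃ q, B q) := by
      rw [← union_eq_iUnion, sdiff_eq, compl_inter, compl_compl]
    rw [this]
    refine CountablyInjective.iUnion ?_
    rintro (_ | _)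
    · exact CountablyInjective.iUnion fun q => countablyInjective_of_injOn (hBm q) (hBi q)
    · exact hYc
  · intro j k hjk
    rw [eq_empty_iff_forall_notMem]
    intro x hx
    obtain ⟨l, hl, hlB⟩ := hB (j, k) hjk
    obtain ⟨z, hz, rfl⟩ := hx l hl
    exact hz.2.2 (mem_iUnion.2 ⟨(j, k), hlB ⟨⟨hz.1, hz.2.1⟩, common_mono hsub hx⟩⟩)

theorem exists_alive_extension_all (hp : Continuous p)
    (hb : ∀ z, ∀ U, IsOpen U → z ∈ U → ∃ i, z ∈ b i ∧ b i ⊆ U) (hbo : ∀ i, IsOpen (b i))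
    {Y : Set Z} (hY : MeasurableSet Y) (hYc : CountablyInjective p Yᶜ)
    (hst : ∀ Y' ⊆ Y, MeasurableSet Y' →
      CountablyInjective p Y'ᶜ → ∀ a n i, Terminal p b Y' a n i → Terminal p b Y a n i)
    {a : Finset ℕ} (ha : ∀ i ∈ a, ∀ n, ¬ Terminal p b Y a n i) (n : ℕ) :
    ∃ a', (∀ i ∈ a', ∀ n, ¬ Terminal p b Y a' n i) ∧
      ∀ i ∈ a, ∃ j ∈ a', ∃ k ∈ a', Splits b n i j k := by
  have key : ∀ t : Finset ℕ, t ⊆ a → ∃ a', a ⊆ a' ∧ (∀ i ∈ a', ∀ n, ¬ Terminal p b Y a' n i) ∧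
      ∀ i ∈ t, ∃ j ∈ a', ∃ k ∈ a', Splits b n i j k := by
    intro t
    induction t using Finset.induction_on with
    | empty => exact fun _ => ⟨a, subset_rfl, ha, by simp⟩
    | insert i t hi ih =>
      intro ht
      obtain ⟨a', h1, h2, h3⟩ := ih ((Finset.subset_insert _ _).trans ht)
      obtain ⟨j, k, hjk, halive⟩ := exists_alive_extension hp hb hbo hY hYc hst h2
        (h1 (ht (Finset.mem_insert_self _ _))) n
      have hsub : a' ⊆ insert j (insert k a') :=
        (Finset.subset_insert _ _).trans (Finset.subset_insert _ _)
      refine ⟨insert j (insert k a'), h1.trans hsub, halive, ?_⟩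
      intro l hl
      rcases Finset.mem_insert.1 hl with rfl | hl
      · exact ⟨j, by simp, k, by simp, hjk⟩
      · obtain ⟨j', hj', k', hk', h⟩ := h3 l hl
        exact ⟨j', hsub hj', k', hsub hk', h⟩
  obtain ⟨a', -, h2, h3⟩ := key a subset_rfl
  exact ⟨a', h2, h3⟩

/-- Otherwise the alive families can be extended forever and contain a Cantor scheme. All its
branches lie in a single fiber, which is then uncountable. -/
theorem countablyInjective_univ_of_metric (hp : Continuous p)
    (hc : ∀ x, (p ⁻¹' {x}).Countable) : CountablyInjective p (univ : Set Z) := by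
  obtain ⟨b, hb0, hbo, hb⟩ : ∃ b : ℕ → Set Z, b 0 = univ ∧ (∀ i, IsOpen (b i)) ∧
      ∀ z, ∀ U, IsOpen U → z ∈ U → ∃ i, z ∈ b i ∧ b i ⊆ U := by
    have hB := TopologicalSpace.isBasis_countableBasis Z
    obtain ⟨e, he⟩ := ((TopologicalSpace.countable_countableBasis Z).insert univ).exists_eq_range
      (insert_nonempty _ _)
    -- Index 0 is reserved for the whole space, so that the construction can start from the family
    -- `{0}`.
    refine ⟨fun n => Nat.casesOn n univ e, rfl, ?_, ?_⟩
    · rintro (_ | n)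
      · exact isOpen_univ
      · have : e n ∈ insert univ (TopologicalSpace.countableBasis Z) := he ▸ mem_range_self n
        rcases this with h | h
        · exact h ▸ isOpen_univ
        · exact hB.isOpen h
    · intro z U hU hz
      obtain ⟨v, hv, hzv, hvU⟩ := hB.exists_subset_of_mem_open hz hU
      obtain ⟨n, rfl⟩ : v ∈ range e := he ▸ mem_insert_of_mem _ hv
      exact ⟨n + 1, hzv, hvU⟩
  obtain ⟨Y, hY, hYc, hst⟩ := exists_stable p b
  by_contra hnot
  have h0 : ∀ i ∈ ({0} : Finset ℕ), ∀ n, ¬ Terminal p b Y {0} n i := by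
    intro i hi n ht
    obtain ⟨B, h1, h2, h3⟩ := exists_measurable_of_terminal hp hb hbo hY ht
    have hYB : Y ⊆ B := by
      intro z hz
      refine h1 ⟨⟨?_, hz⟩, fun l hl => ⟨z, ⟨?_, hz⟩, rfl⟩⟩
      · rw [Finset.mem_singleton.1 hi, hb0]; trivial
      · rw [Finset.mem_singleton.1 hl, hb0]; trivial
    apply hnot
    have : (univ : Set Z) = ⋃ c : Bool, cond c Yᶜ B := by
      rw [← union_eq_iUnion, eq_comm, eq_univ_iff_forall]
      intro z
      by_cases hz : z ∈ Y
      · exact .inr (hYB hz)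
      · exact .inl hz
    rw [this]
    refine CountablyInjective.iUnion ?_
    rintro (_ | _)
    · exact countablyInjective_of_injOn h2 h3
    · exact hYc
  let Alive := {a : Finset ℕ // ∀ i ∈ a, ∀ n, ¬ Terminal p b Y a n i}
  have hext : ∀ (n : ℕ) (a : Alive), ∃ a' : Alive,
      ∀ i ∈ a.1, ∃ j ∈ a'.1, ∃ k ∈ a'.1, Splits b n i j k := by
    intro n a
    obtain ⟨a', h1, h2⟩ := exists_alive_extension_all hp hb hbo hY hYc hst a.2 n
    exact ⟨⟨a', h1⟩, h2⟩
  choose next hnext using hext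
  let s : ℕ → Alive := fun n => Nat.rec ⟨{0}, h0⟩ (fun n a => next n a) n
  have hs : ∀ n, ∀ i, ∃ c : Bool → ℕ, i ∈ (s n).1 →
      (∀ t, c t ∈ (s (n + 1)).1) ∧ Splits b n i (c false) (c true) := by
    intro n i
    by_cases hi : i ∈ (s n).1
    · obtain ⟨j, hj, k, hk, h⟩ := hnext n (s n) i hi
      refine ⟨fun t => cond t k j, fun _ => ⟨?_, h⟩⟩
      rintro (_ | _) <;> assumption
    · exact ⟨fun _ => 0, fun h => absurd h hi⟩
  choose child hchild using hs
  let idx : List Bool → ℕ := fun l => List.rec 0 (fun t l i => child l.length i t) l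
  have hidx : ∀ l, idx l ∈ (s l.length).1 := by
    intro l
    induction l with
    | nil => exact Finset.mem_singleton_self 0
    | cons t l ih => exact (hchild _ _ ih).1 t
  have hspl : ∀ l, Splits b l.length (idx l) (idx (false :: l)) (idx (true :: l)) :=
    fun l => (hchild _ _ (hidx l)).2
  have hcl : ∀ t l, closure (b (idx (t :: l))) ⊆ b (idx l) ∧
      Metric.ediam (b (idx (t :: l))) ≤ ((l.length : ℝ≥0∞) + 1)⁻¹ := by
    intro t l
    cases t
    · exact (hspl l).1 _ (.inl rfl)
    · exact (hspl l).1 _ (.inr rfl)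
  have hcommon : ∀ n, ∃ x, ∀ i ∈ (s n).1, ∃ z ∈ b i ∩ Y, p z = x := by
    intro n
    have hne : (s n).1.Nonempty :=
      ⟨idx (List.replicate n true), by simpa using hidx (List.replicate n true)⟩
    obtain ⟨i, hi⟩ := hne
    have := (s n).2 i hi n
    unfold Terminal at this
    push Not at this
    obtain ⟨j, k, -, x, hx⟩ := this
    exact ⟨x, fun l hl => hx l (by simp [hl])⟩
  choose x hx using hcommon
  let A : List Bool → Set Z := fun l => b (idx l)
  have hanti : CantorScheme.ClosureAntitone A := fun l t => (hcl t l).1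
  have hdisj : CantorScheme.Disjoint A := by
    rintro l (_ | _) (_ | _) h
    · exact absurd rfl h
    · exact (hspl l).2
    · exact (hspl l).2.symm
    · exact absurd rfl h
  have hdiam : CantorScheme.VanishingDiam A := by
    intro f
    rw [← tendsto_add_atTop_iff_nat 1]
    refine tendsto_of_tendsto_of_tendsto_of_le_of_le tendsto_const_nhds
      (ENNReal.tendsto_inv_nat_nhds_zero.comp (tendsto_add_atTop_nat 1)) (fun _ => zero_le) ?_
    intro n
    have := (hcl (f n) (PiNat.res f n)).2
    simpa [A, PiNat.res_succ, PiNat.res_length] using this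
  have hne : ∀ l, (A l).Nonempty := by
    intro l
    obtain ⟨z, hz, -⟩ := hx _ _ (hidx l)
    exact ⟨z, hz.1⟩
  have hdom := hanti.map_of_vanishingDiam hdiam hne
  let f : (ℕ → Bool) → Z := fun σ => (CantorScheme.inducedMap A).2 ⟨σ, hdom ▸ mem_univ σ⟩
  have hfinj : Function.Injective f := by
    intro σ τ h
    exact congrArg Subtype.val (hdisj.map_injective h)
  -- The set of step `n` along `σ` has a point over `x n`, and these points converge to `f σ`. Since
  -- `x` does not depend on `σ`, neither does the limit.
  have hlim : ∀ σ, Tendsto x atTop (𝓝 (p (f σ))) := by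
    intro σ
    have hz : ∀ n, ∃ z ∈ b (idx (PiNat.res σ n)), p z = x n := by
      intro n
      obtain ⟨z, hz, hzx⟩ := hx n (idx (PiNat.res σ n)) (by
        simpa [PiNat.res_length] using hidx (PiNat.res σ n))
      exact ⟨z, hz.1, hzx⟩
    choose z hzb hzx using hz
    have : Tendsto z atTop (𝓝 (f σ)) := by
      rw [tendsto_iff_edist_tendsto_0]
      refine tendsto_of_tendsto_of_tendsto_of_le_of_le tendsto_const_nhds (hdiam σ)
        (fun _ => zero_le) ?_
      intro n
      exact Metric.edist_le_ediam_of_mem (hzb n) (CantorScheme.map_mem _ n)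
    have h2 := (hp.tendsto _).comp this
    refine h2.congr fun n => hzx n
  have hfib : range f ⊆ p ⁻¹' {p (f fun _ => true)} := by
    rintro _ ⟨σ, rfl⟩
    exact tendsto_nhds_unique (hlim σ) (hlim _)
  have hcR := (hc _).mono hfib
  rw [← image_univ] at hcR
  have hcu : (univ : Set (ℕ → Bool)).Countable := countable_of_injective_of_countable_image
    hfinj.injOn hcR
  rw [countable_univ_iff] at hcu
  obtain ⟨e, he⟩ := exists_surjective_nat (ℕ → Bool)
  obtain ⟨n, hn⟩ := he fun n => !(e n n)
  have := congrFun hn n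
  simp at this

end

/-- The Lusin–Novikov theorem. -/
theorem exists_injOn_cover [MeasurableSpace Z] [StandardBorelSpace Z] [MeasurableSpace X]
    [StandardBorelSpace X] {p : Z → X} (hp : Measurable p) (hc : ∀ x, (p ⁻¹' {x}).Countable) :
    ∃ B : ℕ → Set Z, (∀ n, MeasurableSet (B n) ∧ InjOn p (B n)) ∧ ⋃ n, B n = univ := by
  let _ := upgradeStandardBorel X
  have key : ∀ t : TopologicalSpace Z, @PolishSpace Z t → @BorelSpace Z t _ → Continuous p →
      ∃ B : ℕ → Set Z, (∀ n, MeasurableSet (B n) ∧ InjOn p (B n)) ∧ ⋃ n, B n = univ := by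
    intro t ht hb hcont
    let _ := TopologicalSpace.upgradeIsCompletelyMetrizable Z
    obtain ⟨B, h1, h2⟩ := countablyInjective_univ_of_metric hcont hc
    exact ⟨B, h1, univ_subset_iff.1 h2⟩
  let t := upgradeStandardBorel Z
  -- A finer Polish topology with the same Borel sets makes `p` continuous.
  obtain ⟨t', ht', hcont, hpol⟩ := hp.exists_continuous
  refine key t' hpol ⟨?_⟩ hcont
  rw [borel_eq_borel_of_le hpol t.toPolishSpace ht']
  exact t.measurable_eq

end LusinNovikov

/-! ### The Feldman–Moore theorem. -/

namespace BorelCocycle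

open Set MeasureTheory

variable {X : Type*}

/-- A measurable symmetric partial function extends to a measurable involution fixing the points
outside its domain. -/
theorem exists_measurable_involution [MeasurableSpace X] [StandardBorelSpace X] {S : Set (X × X)}
    (hS : MeasurableSet S) (hsymm : ∀ x y, (x, y) ∈ S → (y, x) ∈ S)
    (huniq : ∀ x y z, (x, y) ∈ S → (x, z) ∈ S → y = z) :
    ∃ g : X → X, Measurable g ∧ (∀ x, g (g x) = x) ∧ (∀ x y, (x, y) ∈ S → g x = y) ∧
      ∀ x, g x = x ∨ (x, g x) ∈ S := by
  classical
  let g : X → X := fun x => if h : ∃ y, (x, y) ∈ S then h.choose else x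
  have hg : ∀ x y, (x, y) ∈ S → g x = y := by
    intro x y h
    have h' : ∃ y, (x, y) ∈ S := ⟨y, h⟩
    simp only [g, dif_pos h']
    exact huniq _ _ _ h'.choose_spec h
  have hg' : ∀ x, g x = x ∨ (x, g x) ∈ S := by
    intro x
    by_cases h : ∃ y, (x, y) ∈ S
    · obtain ⟨y, hy⟩ := h
      exact .inr (hg x y hy ▸ hy)
    · exact .inl (dif_neg h)
  have hdom : MeasurableSet {x | ∃ y, (x, y) ∈ S} := by
    have : {x | ∃ y, (x, y) ∈ S} = Prod.fst '' S := by ext; simp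
    rw [this]
    refine hS.image_of_measurable_injOn measurable_fst ?_
    rintro ⟨x, y⟩ h ⟨x', z⟩ h' hxx
    obtain rfl : x = x' := hxx
    rw [huniq x y z h h']
  refine ⟨g, ?_, ?_, hg, hg'⟩
  · intro T hT
    have : g ⁻¹' T = Prod.fst '' (S ∩ Prod.snd ⁻¹' T) ∪ ({x | ∃ y, (x, y) ∈ S}ᶜ ∩ T) := by
      ext x
      by_cases h : ∃ y, (x, y) ∈ S
      · obtain ⟨y, hy⟩ := h
        have hgx := hg x y hy
        constructor
        · intro hx
          exact .inl ⟨(x, y), ⟨hy, show y ∈ T from hgx ▸ hx⟩, rfl⟩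
        · rintro (⟨⟨x', z⟩, ⟨h1, h2⟩, rfl⟩ | ⟨h1, -⟩)
          · show g x' ∈ T
            rw [hg _ _ h1]; exact h2
          · exact absurd ⟨y, hy⟩ h1
      · have hgx : g x = x := dif_neg h
        constructor
        · intro hx
          exact .inr ⟨h, show x ∈ T from hgx ▸ hx⟩
        · rintro (⟨⟨x', z⟩, ⟨h1, h2⟩, rfl⟩ | ⟨-, h2⟩)
          · exact absurd ⟨z, h1⟩ h
          · show g x ∈ T
            rw [hgx]; exact h2
    rw [this]
    refine MeasurableSet.union ?_ (hdom.compl.inter hT)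
    refine (hS.inter (measurable_snd hT)).image_of_measurable_injOn measurable_fst ?_
    rintro ⟨x, y⟩ h ⟨x', z⟩ h' hxx
    obtain rfl : x = x' := hxx
    rw [huniq x y z h.1 h'.1]
  · intro x
    rcases hg' x with h | h
    · rw [h, h]
    · exact hg _ _ (hsymm _ _ h)

/-- `γ` is a sequence of Borel involutions whose graphs have union `E`. -/
structure Generates [MeasurableSpace X] (E : Setoid X) (γ : ℕ → X → X) : Prop where
  meas : ∀ n, Measurable (γ n)
  invol : ∀ n x, γ n (γ n x) = x
  rel : ∀ n x, E x (γ n x)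
  surj : ∀ x y, E x y → ∃ n, γ n x = y

/-- The Feldman–Moore theorem. -/
theorem exists_generates [MeasurableSpace X] [StandardBorelSpace X] {E : Setoid X}
    (hE : IsBorelRel E) (hEc : IsCountableRel E) : ∃ γ : ℕ → X → X, Generates E γ := by
  let Z := {p : X × X // E p.1 p.2}
  have : StandardBorelSpace Z := MeasurableSet.standardBorel hE
  have hm : Measurable (fun z : Z => z.1) := measurable_subtype_coe
  have h1 : ∀ x, ((fun z : Z => z.1.1) ⁻¹' {x}).Countable := by
    intro x
    refine MapsTo.countable_of_injOn (t := {y | E y x}) (f := fun z : Z => z.1.2) ?_ ?_ (hEc x)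
    · rintro ⟨⟨a, y⟩, h⟩ rfl
      exact E.symm h
    · rintro ⟨⟨a, y⟩, h⟩ rfl ⟨⟨a', y'⟩, h'⟩ (rfl : a' = a) (rfl : y = y')
      rfl
  have h2 : ∀ x, ((fun z : Z => z.1.2) ⁻¹' {x}).Countable := by
    intro x
    refine MapsTo.countable_of_injOn (t := {y | E y x}) (f := fun z : Z => z.1.1) ?_ ?_ (hEc x)
    · rintro ⟨⟨a, y⟩, h⟩ rfl
      exact h
    · rintro ⟨⟨a, y⟩, h⟩ rfl ⟨⟨a', y'⟩, h'⟩ (rfl : y' = y) (rfl : a = a')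
      rfl
  obtain ⟨B, hB, hBu⟩ := LusinNovikov.exists_injOn_cover (measurable_fst.comp hm) h1
  obtain ⟨B', hB', hBu'⟩ := LusinNovikov.exists_injOn_cover (measurable_snd.comp hm) h2
  let _ := upgradeStandardBorel X
  have hbasis := TopologicalSpace.isBasis_countableBasis X
  have hcb : Countable (TopologicalSpace.countableBasis X) :=
    (TopologicalSpace.countable_countableBasis X).to_subtype
  -- The sets `B` and `B'` make this the graph of a partial injection. The basic open set makes its
  -- domain and range disjoint, so that together with its inverse it is still single-valued.
  let G : ℕ × ℕ × TopologicalSpace.countableBasis X → Set (X × X) := fun c =>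
    (Subtype.val '' (B c.1 ∩ B' c.2.1)) ∩ {p | p.1 ∈ c.2.2.1 ∧ p.2 ∉ c.2.2.1}
  have hG : ∀ c, MeasurableSet (G c) := by
    intro c
    have hU := (hbasis.isOpen c.2.2.2).measurableSet
    exact (MeasurableSet.subtype_image hE ((hB c.1).1.inter (hB' c.2.1).1)).inter
      ((measurable_fst hU).inter (measurable_snd hU.compl))
  have hGE : ∀ c x y, (x, y) ∈ G c → E x y := by
    rintro c x y ⟨⟨⟨p, hp⟩, -, rfl⟩, -⟩
    exact hp
  have hG1 : ∀ c x y z, (x, y) ∈ G c → (x, z) ∈ G c → y = z := by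
    rintro c x y z ⟨⟨⟨p, hp⟩, hpB, rfl⟩, -⟩ ⟨⟨⟨q, hq⟩, hqB, rfl⟩, -⟩
    have := (hB c.1).2 hpB.1 hqB.1 rfl
    exact congrArg (fun z : Z => z.1.2) this
  have hG2 : ∀ c x y z, (y, x) ∈ G c → (z, x) ∈ G c → y = z := by
    rintro c x y z ⟨⟨⟨p, hp⟩, hpB, rfl⟩, -⟩ ⟨⟨⟨q, hq⟩, hqB, rfl⟩, -⟩
    have := (hB' c.2.1).2 hpB.2 hqB.2 rfl
    exact congrArg (fun z : Z => z.1.1) this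
  have hinv : ∀ c, ∃ g : X → X, Measurable g ∧ (∀ x, g (g x) = x) ∧ (∀ x, E x (g x)) ∧
      ∀ x y, (x, y) ∈ G c → g x = y ∧ g y = x := by
    intro c
    obtain ⟨g, h1, h2, h3, h4⟩ := exists_measurable_involution (S := G c ∪ Prod.swap ⁻¹' G c)
      ((hG c).union (measurable_swap (hG c))) (by
        rintro x y (h | h)
        · exact .inr h
        · exact .inl h) (by
        rintro x y z (h | h) (h' | h')
        · exact hG1 c x y z h h'
        · exact absurd h.2.1 h'.2.2
        · exact absurd h'.2.1 h.2.2
        · exact hG2 c x y z h h')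
    refine ⟨g, h1, h2, ?_, fun x y h => ⟨h3 _ _ (.inl h), h3 _ _ (.inr h)⟩⟩
    intro x
    rcases h4 x with h | h | h
    · rw [h]
    · exact hGE c _ _ h
    · exact E.symm (hGE c _ _ h)
  choose g hgm hgi hgE hgG using hinv
  -- `none` stands for the identity, which supplies the diagonal that every `G c` avoids.
  obtain ⟨e, he⟩ := exists_surjective_nat (Option (ℕ × ℕ × TopologicalSpace.countableBasis X))
  refine ⟨fun n => (e n).elim id g, ?_, ?_, ?_, ?_⟩
  · intro n
    rcases e n with - | c
    · exact measurable_id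
    · exact hgm c
  · intro n x
    rcases e n with - | c
    · rfl
    · exact hgi c x
  · intro n x
    rcases e n with - | c
    · exact E.refl x
    · exact hgE c x
  · intro x y hxy
    by_cases hne : x = y
    · obtain ⟨n, hn⟩ := he none
      exact ⟨n, by simpa [hn] using hne⟩
    · have hz1 : (⟨(x, y), hxy⟩ : Z) ∈ ⋃ n, B n := hBu ▸ mem_univ _
      have hz2 : (⟨(x, y), hxy⟩ : Z) ∈ ⋃ n, B' n := hBu' ▸ mem_univ _
      obtain ⟨n, hn⟩ := mem_iUnion.1 hz1
      obtain ⟨m, hm⟩ := mem_iUnion.1 hz2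
      obtain ⟨U, hU, hxU, hUy⟩ := hbasis.exists_subset_of_mem_open (show x ∈ ({y} : Set X)ᶜ from hne)
        isOpen_compl_singleton
      obtain ⟨k, hk⟩ := he (some (n, m, ⟨U, hU⟩))
      refine ⟨k, ?_⟩
      simp only [hk, Option.elim]
      exact (hgG (n, m, ⟨U, hU⟩) x y
        ⟨⟨⟨(x, y), hxy⟩, ⟨hn, hm⟩, rfl⟩, hxU, fun h => hUy h rfl⟩).1

/-! ### Measurability of quantifiers, finiteness and sizes along classes. -/

section Measurability

variable [MeasurableSpace X] {E : Setoid X} {γ : ℕ → X → X}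

theorem Generates.measurableSet_of_forall [StandardBorelSpace X] (hγ : Generates E γ) {R : X → X → Prop}
    (hR : ∀ x y, R x y → E x y) (h : ∀ n, MeasurableSet {x | R x (γ n x)}) :
    MeasurableSet {p : X × X | R p.1 p.2} := by
  have : {p : X × X | R p.1 p.2} = ⋃ n, {p | γ n p.1 = p.2} ∩ Prod.fst ⁻¹' {x | R x (γ n x)} := by
    ext ⟨x, y⟩
    simp only [mem_ofPred_eq, mem_iUnion, mem_inter_iff, mem_preimage]
    constructor
    · intro hxy
      obtain ⟨n, rfl⟩ := hγ.surj x y (hR _ _ hxy)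
      exact ⟨n, rfl, hxy⟩
    · rintro ⟨n, rfl, h⟩
      exact h
  rw [this]
  exact .iUnion fun n => (measurableSet_eq_fun ((hγ.meas n).comp measurable_fst)
    measurable_snd).inter (measurable_fst (h n))

theorem Generates.measurableSet_rel (hγ : Generates E γ) {R : X → X → Prop}
    (h : MeasurableSet {p : X × X | R p.1 p.2}) (m n : ℕ) :
    MeasurableSet {x | R (γ m x) (γ n x)} :=
  ((hγ.meas m).prodMk (hγ.meas n)) h

theorem Generates.measurableSet_rel_right (hγ : Generates E γ) {R : X → X → Prop}
    (h : MeasurableSet {p : X × X | R p.1 p.2}) (n : ℕ) :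
    MeasurableSet {x | R x (γ n x)} :=
  (measurable_id.prodMk (hγ.meas n)) h

theorem Generates.measurableSet_exists (hγ : Generates E γ) {p : X → X → Prop}
    (h : ∀ n, MeasurableSet {x | p x (γ n x)}) : MeasurableSet {x | ∃ y, E x y ∧ p x y} := by
  have : {x | ∃ y, E x y ∧ p x y} = ⋃ n, {x | p x (γ n x)} := by
    ext x
    simp only [mem_ofPred_eq, mem_iUnion]
    constructor
    · rintro ⟨y, hy, hp⟩
      obtain ⟨n, rfl⟩ := hγ.surj x y hy
      exact ⟨n, hp⟩
    · rintro ⟨n, hn⟩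
      exact ⟨_, hγ.rel n x, hn⟩
  rw [this]
  exact .iUnion h

theorem Generates.measurableSet_forall (hγ : Generates E γ) {p : X → X → Prop}
    (h : ∀ n, MeasurableSet {x | p x (γ n x)}) : MeasurableSet {x | ∀ y, E x y → p x y} := by
  have := (hγ.measurableSet_exists (p := fun x y => ¬ p x y) fun n => (h n).compl).compl
  convert this using 1
  ext x
  simp

theorem Generates.measurableSet_finite [StandardBorelSpace X] (hγ : Generates E γ) {R : X → X → Prop}
    (hR : ∀ x y, R x y → E x y) (h : ∀ n, MeasurableSet {x | R x (γ n x)}) :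
    MeasurableSet {x | {y | R x y}.Finite} := by
  have : {x | {y | R x y}.Finite} =
      ⋃ N : ℕ, ⋂ n : ℕ, {x | R x (γ n x)}ᶜ ∪ ⋃ k ∈ Finset.range N, {x | γ k x = γ n x} := by
    ext x
    simp only [mem_ofPred_eq, mem_iUnion, mem_iInter, mem_union, mem_compl_iff, exists_prop]
    constructor
    · intro hf
      have : ∀ y, ∃ n, R x y → γ n x = y := by
        intro y
        by_cases hy : R x y
        · obtain ⟨n, hn⟩ := hγ.surj x y (hR _ _ hy)
          exact ⟨n, fun _ => hn⟩
        · exact ⟨0, fun h => absurd h hy⟩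
      choose idx hidx using this
      refine ⟨hf.toFinset.sup idx + 1, fun n => ?_⟩
      by_cases hn : R x (γ n x)
      · refine .inr ⟨idx (γ n x), ?_, hidx _ hn⟩
        rw [Finset.mem_range, Nat.lt_succ_iff]
        exact Finset.le_sup (hf.mem_toFinset.2 hn)
      · exact .inl hn
    · rintro ⟨N, hN⟩
      refine ((Finset.range N).finite_toSet.image (fun k => γ k x)).subset ?_
      intro y hy
      obtain ⟨n, rfl⟩ := hγ.surj x y (hR _ _ hy)
      rcases hN n with h | ⟨k, hk, hkn⟩
      · exact absurd hy h
      · exact ⟨k, hk, hkn⟩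
  rw [this]
  exact .iUnion fun N => .iInter fun n => (h n).compl.union <|
    Finset.measurableSet_biUnion _ fun k _ => measurableSet_eq_fun (hγ.meas k) (hγ.meas n)

theorem Generates.measurable_cocycle (hγ : Generates E γ) {ρ : X → X → ℝ} (hρ : IsBorelCocycle E ρ) (n : ℕ) :
    Measurable fun x => ρ (γ n x) x := by
  have : Measurable fun x => (⟨(γ n x, x), E.symm (hγ.rel n x)⟩ : {p : X × X // E p.1 p.2}) :=
    ((hγ.meas n).prodMk measurable_id).subtype_mk
  exact hρ.borel.comp this

/-- Counting each point `y` only at the least `n` with `γ n x = y` turns the sum over a subset of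
the class into a series of measurable functions. -/
theorem Generates.measurable_size [StandardBorelSpace X] (hγ : Generates E γ) {ρ : X → X → ℝ}
    (hρ : IsBorelCocycle E ρ) {R : X → X → Prop}
    (hR : ∀ x y, R x y → E x y) (h : ∀ n, MeasurableSet {x | R x (γ n x)}) :
    Measurable fun x => size ρ x {y | R x y} := by
  classical
  have hsize : ∀ x, size ρ x {y | R x y} =
      ∑' n, if R x (γ n x) ∧ ∀ k < n, γ k x ≠ γ n x then ENNReal.ofReal (ρ (γ n x) x) else 0 := by
    intro x
    let I := {n : ℕ | R x (γ n x) ∧ ∀ k < n, γ k x ≠ γ n x}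
    have h1 : ∑' n, (if R x (γ n x) ∧ ∀ k < n, γ k x ≠ γ n x then ENNReal.ofReal (ρ (γ n x) x)
        else 0) = ∑' n : I, ENNReal.ofReal (ρ (γ n x) x) := by
      rw [tsum_subtype I (fun n => ENNReal.ofReal (ρ (γ n x) x))]
      refine tsum_congr fun n => ?_
      simp only [indicator, I, mem_ofPred_eq]
    rw [h1]
    unfold size
    symm
    let f : I → {y | R x y} := fun n => ⟨γ n x, n.2.1⟩
    have hf : Function.Bijective f := by
      constructor
      · intro n m hnm
        have hnm' : γ n x = γ m x := congrArg Subtype.val hnm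
        rcases lt_trichotomy n.1 m.1 with hlt | heq | hlt
        · exact absurd hnm' (m.2.2 _ hlt)
        · exact Subtype.ext heq
        · exact absurd hnm'.symm (n.2.2 _ hlt)
      · rintro ⟨y, hy⟩
        have hex := hγ.surj x y (hR _ _ hy)
        have hspec := Nat.find_spec hex
        refine ⟨⟨Nat.find hex, ?_, ?_⟩, Subtype.ext hspec⟩
        · rw [hspec]; exact hy
        · intro k hk
          rw [hspec]
          exact Nat.find_min hex hk
    exact (Equiv.ofBijective f hf).tsum_eq (fun y : {y | R x y} => ENNReal.ofReal (ρ y x))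
  simp_rw [hsize]
  refine Measurable.tsum fun n => Measurable.ite ?_
    (hγ.measurable_cocycle hρ n).ennreal_ofReal measurable_const
  refine (h n).inter ?_
  have : {x | ∀ k < n, γ k x ≠ γ n x} = ⋂ k ∈ Finset.range n, {x | γ k x = γ n x}ᶜ := by
    ext; simp
  show MeasurableSet {x | ∀ k < n, γ k x ≠ γ n x}
  rw [this]
  exact Finset.measurableSet_biInter _ fun k _ =>
    (measurableSet_eq_fun (hγ.meas k) (hγ.meas n)).compl

end Measurability

/-! ### Borel families of finite sets. -/

/-- `R` is a Borel partial equivalence relation contained in `E` with finite classes. -/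
structure IsPartialFiniteBorel [MeasurableSpace X] (E : Setoid X) (R : X → X → Prop) : Prop where
  le : ∀ x y, R x y → E x y
  symm : ∀ x y, R x y → R y x
  trans : ∀ x y z, R x y → R y z → R x z
  finite : ∀ x, {y | R x y}.Finite
  borel : MeasurableSet {p : X × X | R p.1 p.2}

theorem IsPartialFiniteBorel.refl_left [MeasurableSpace X] {E : Setoid X} {R : X → X → Prop}
    (hR : IsPartialFiniteBorel E R) {x y : X} (h : R x y) : R x x :=
  hR.trans _ _ _ h (hR.symm _ _ h)

/-- Countably many finite Borel partial equivalence relations suffice for every finite subset of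
every class to be a class of one of them. -/
theorem Generates.exists_partialFiniteBorel_cover [MeasurableSpace X] [StandardBorelSpace X]
    {E : Setoid X} {γ : ℕ → X → X} (hγ : Generates E γ) :
    ∃ Q : ℕ → X → X → Prop, (∀ n, IsPartialFiniteBorel E (Q n)) ∧
      ∀ S : Set X, S.Finite → (∀ x ∈ S, ∀ y ∈ S, E x y) →
        ∃ n, ∀ x ∈ S, Q n x x ∧ {y | Q n x y} = S := by
  classical
  let _ := upgradeStandardBorel X
  have hbasis := TopologicalSpace.isBasis_countableBasis X
  have hcb : Countable (TopologicalSpace.countableBasis X) :=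
    (TopologicalSpace.countable_countableBasis X).to_subtype
  -- The finite sets `{γ i x | i ∈ c.1}` for distinct `x ∈ V c` are disjoint: `γ i x = γ j x'` gives
  -- `x' = γ j (γ i x)`, which lies in the open set and so equals `x`.
  let V : Finset ℕ × TopologicalSpace.countableBasis X → Set X := fun c =>
    {x | x ∈ c.2.1 ∧ ∀ i ∈ c.1, ∀ j ∈ c.1, γ j (γ i x) ∈ c.2.1 → γ j (γ i x) = x}
  have hVm : ∀ c, MeasurableSet (V c) := by
    intro c
    have hU := (hbasis.isOpen c.2.2).measurableSet
    have : V c = c.2.1 ∩ ⋂ i ∈ c.1, ⋂ j ∈ c.1, {x | γ j (γ i x) ∈ c.2.1}ᶜ ∪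
        {x | γ j (γ i x) = x} := by
      ext x
      simp only [V, mem_ofPred_eq, mem_inter_iff, mem_iInter, mem_union, mem_compl_iff,
        imp_iff_not_or]
    rw [this]
    refine hU.inter (Finset.measurableSet_biInter _ fun i _ => Finset.measurableSet_biInter _
      fun j _ => ?_)
    have hm := (hγ.meas j).comp (hγ.meas i)
    exact (hm hU).compl.union (measurableSet_eq_fun hm measurable_id)
  let Q : Finset ℕ × TopologicalSpace.countableBasis X → X → X → Prop := fun c y z =>
    ∃ x ∈ V c, (∃ i ∈ c.1, γ i x = y) ∧ ∃ j ∈ c.1, γ j x = z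
  have hVu : ∀ c, ∀ x ∈ V c, ∀ x' ∈ V c, ∀ i ∈ c.1, ∀ j ∈ c.1, γ i x = γ j x' → x = x' := by
    intro c x hx x' hx' i hi j hj h
    have hj' : γ j (γ i x) = x' := by rw [h, hγ.invol]
    rw [← hj']
    exact (hx.2 i hi j hj (hj' ▸ hx'.1)).symm
  have hQ : ∀ c, IsPartialFiniteBorel E (Q c) := by
    intro c
    have hle : ∀ x y, Q c x y → E x y := by
      rintro y z ⟨x, -, ⟨i, -, rfl⟩, ⟨j, -, rfl⟩⟩
      exact E.trans (E.symm (hγ.rel i x)) (hγ.rel j x)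
    refine ⟨hle, ?_, ?_, ?_, ?_⟩
    · rintro y z ⟨x, hx, h1, h2⟩
      exact ⟨x, hx, h2, h1⟩
    · rintro y z w ⟨x, hx, h1, ⟨j, hj, rfl⟩⟩ ⟨x', hx', ⟨i, hi, h⟩, h2⟩
      obtain rfl := hVu c x' hx' x hx i hi j hj h
      exact ⟨x', hx, h1, h2⟩
    · intro y
      by_cases hy : ∃ x ∈ V c, ∃ i ∈ c.1, γ i x = y
      · obtain ⟨x, hx, i, hi, rfl⟩ := hy
        refine (c.1.finite_toSet.image (fun j => γ j x)).subset ?_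
        rintro z ⟨x', hx', ⟨i', hi', h⟩, ⟨j, hj, rfl⟩⟩
        obtain rfl := hVu c x' hx' x hx i' hi' i hi h
        exact ⟨j, hj, rfl⟩
      · convert finite_empty
        ext z
        simp only [mem_ofPred_eq, mem_empty_iff_false, iff_false]
        rintro ⟨x, hx, h, -⟩
        exact hy ⟨x, hx, h⟩
    · refine hγ.measurableSet_of_forall hle fun n => ?_
      have : {y | Q c y (γ n y)} =
          ⋃ i ∈ c.1, ⋃ j ∈ c.1, γ i ⁻¹' V c ∩ {y | γ j (γ i y) = γ n y} := by
        ext y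
        simp only [Q, mem_ofPred_eq, mem_iUnion, mem_inter_iff, mem_preimage, exists_prop]
        constructor
        · rintro ⟨x, hx, ⟨i, hi, rfl⟩, ⟨j, hj, h⟩⟩
          exact ⟨i, hi, j, hj, by rwa [hγ.invol], by rw [hγ.invol, h]⟩
        · rintro ⟨i, hi, j, hj, hV, h⟩
          exact ⟨_, hV, ⟨i, hi, hγ.invol i y⟩, ⟨j, hj, h⟩⟩
      rw [this]
      refine Finset.measurableSet_biUnion _ fun i _ => Finset.measurableSet_biUnion _ fun j _ => ?_
      exact (hγ.meas i (hVm c)).inter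
        (measurableSet_eq_fun ((hγ.meas j).comp (hγ.meas i)) (hγ.meas n))
  rcases isEmpty_or_nonempty X with hX | ⟨⟨x₀⟩⟩
  · refine ⟨fun _ _ _ => False, fun _ => ⟨?_, ?_, ?_, ?_, ?_⟩, fun S _ _ => ⟨0, ?_⟩⟩
    · exact fun x => (hX.false x).elim
    · exact fun x => (hX.false x).elim
    · exact fun x => (hX.false x).elim
    · exact fun x => (hX.false x).elim
    · exact .empty
    · exact fun x => (hX.false x).elim
  obtain ⟨U₀, hU₀, -⟩ := hbasis.exists_subset_of_mem_open (mem_univ x₀) isOpen_univ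
  have : Nonempty (Finset ℕ × TopologicalSpace.countableBasis X) := ⟨(∅, ⟨U₀, hU₀⟩)⟩
  obtain ⟨e, he⟩ := exists_surjective_nat (Finset ℕ × TopologicalSpace.countableBasis X)
  refine ⟨fun n => Q (e n), fun n => hQ _, ?_⟩
  intro S hS hSE
  rcases S.eq_empty_or_nonempty with rfl | ⟨x, hx⟩
  · exact ⟨0, by simp⟩
  have hidx : ∀ y, ∃ n, y ∈ S → γ n x = y := by
    intro y
    by_cases hy : y ∈ S
    · obtain ⟨n, hn⟩ := hγ.surj x y (hSE _ hx _ hy)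
      exact ⟨n, fun _ => hn⟩
    · exact ⟨0, fun h => absurd h hy⟩
  choose idx hidx using hidx
  let s : Finset ℕ := hS.toFinset.image idx
  have hs : ∀ y, (∃ i ∈ s, γ i x = y) ↔ y ∈ S := by
    intro y
    simp only [s, Finset.mem_image, Finite.mem_toFinset]
    constructor
    · rintro ⟨i, ⟨z, hz, rfl⟩, rfl⟩
      rwa [hidx z hz]
    · exact fun hy => ⟨idx y, ⟨y, hy, rfl⟩, hidx y hy⟩
  let bad : Set X := ((s ×ˢ s).image fun q => γ q.2 (γ q.1 x)) \ {x}
  have hbad : IsClosed bad := (Finite.sdiff (Finset.finite_toSet _)).isClosed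
  obtain ⟨U, hU, hxU, hUb⟩ := hbasis.exists_subset_of_mem_open
    (show x ∈ badᶜ from fun h => h.2 rfl) hbad.isOpen_compl
  obtain ⟨n, hn⟩ := he (s, ⟨U, hU⟩)
  have hxV : x ∈ V (e n) := by
    rw [hn]
    refine ⟨hxU, fun i hi j hj h => ?_⟩
    by_contra hne
    refine hUb h ⟨?_, hne⟩
    simp only [Finset.coe_image, mem_image, Finset.mem_coe, Finset.mem_product]
    exact ⟨(i, j), ⟨hi, hj⟩, rfl⟩
  have hmem : ∀ y ∈ S, ∀ z, Q (e n) y z ↔ z ∈ S := by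
    intro y hy z
    obtain ⟨i, hi, hiy⟩ := (hs y).2 hy
    have hen : (e n).1 = s := by rw [hn]
    constructor
    · rintro ⟨x', hx', ⟨i', hi', h⟩, h2⟩
      rw [← hen] at hi
      obtain rfl := hVu _ x' hx' x hxV i' hi' i hi (h.trans hiy.symm)
      rw [hen] at h2
      exact (hs z).1 h2
    · intro hz
      refine ⟨x, hxV, ?_, ?_⟩
      · rw [hen]; exact (hs y).2 hy
      · rw [hen]; exact (hs z).2 hz
  refine ⟨n, fun y hy => ⟨(hmem y hy y).2 hy, ?_⟩⟩
  ext z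
  exact hmem y hy z

/-- Maximal disjoint Borel families of finite sets with a given Borel property. -/
theorem Generates.exists_maximal_family [MeasurableSpace X] [StandardBorelSpace X]
    {E : Setoid X} {γ : ℕ → X → X} (hγ : Generates E γ) (P : Set X → Prop)
    (hP : ∀ R, IsPartialFiniteBorel E R → MeasurableSet {x | R x x ∧ P {y | R x y}}) :
    ∃ R, IsPartialFiniteBorel E R ∧ (∀ x, R x x → P {y | R x y}) ∧
      ∀ S : Set X, S.Finite → S.Nonempty → (∀ x ∈ S, ∀ y ∈ S, E x y) → P S → ∃ x ∈ S, R x x := by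
  obtain ⟨Q, hQ, hQS⟩ := hγ.exists_partialFiniteBorel_cover
  -- Classes of one `Q n` are disjoint, so all good ones that avoid `U` can be added at once. A good
  -- finite set is a class of some `Q n`: at stage `n` it is added unless it already meets `U`.
  let next : ℕ → Set X → Set X := fun n U =>
    {x | (Q n x x ∧ P {y | Q n x y}) ∧ ∀ y, E x y → Q n x y → y ∉ U}
  have hnext : ∀ n U, MeasurableSet U → MeasurableSet (next n U) := by
    intro n U hU
    refine (hP _ (hQ n)).inter (hγ.measurableSet_forall fun k => ?_)
    have : {x | Q n x (γ k x) → γ k x ∉ U} = {x | Q n x (γ k x)}ᶜ ∪ γ k ⁻¹' Uᶜ := by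
      ext x
      simp [imp_iff_not_or]
    rw [this]
    exact (hγ.measurableSet_rel_right (hQ n).borel k).compl.union (hγ.meas k hU.compl)
  let U : ℕ → Set X := fun n => Nat.rec ∅ (fun n U => U ∪ next n U) n
  have hUm : ∀ n, MeasurableSet (U n) := by
    intro n
    induction n with
    | zero => exact .empty
    | succ n ih => exact ih.union (hnext n _ ih)
  let V : ℕ → Set X := fun n => next n (U n)
  have hUmono : Monotone U := monotone_nat_of_le_succ fun n => subset_union_left
  have hVU : ∀ m n, m < n → V m ⊆ U n := fun m n h =>
    (subset_union_right : V m ⊆ U m ∪ V m).trans (hUmono (Nat.succ_le_of_lt h))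
  have hVQ : ∀ n x y, x ∈ V n → Q n x y → y ∈ V n := by
    rintro n x y ⟨⟨h1, h2⟩, h3⟩ hxy
    have hyx := (hQ n).symm _ _ hxy
    have hcl : {z | Q n y z} = {z | Q n x z} := by
      ext z
      exact ⟨fun h => (hQ n).trans _ _ _ hxy h, fun h => (hQ n).trans _ _ _ hyx h⟩
    refine ⟨⟨(hQ n).refl_left hyx, hcl ▸ h2⟩, fun z _ hz => ?_⟩
    have := (hQ n).trans _ _ _ hxy hz
    exact h3 z ((hQ n).le _ _ this) this
  have hVself : ∀ n x, x ∈ V n → x ∉ U n := fun n x h => h.2 x (E.refl x) h.1.1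
  have hVdisj : ∀ m n x, x ∈ V m → x ∈ V n → m = n := by
    intro m n x hm hn
    rcases lt_trichotomy m n with h | h | h
    · exact absurd (hVU m n h hm) (hVself n x hn)
    · exact h
    · exact absurd (hVU n m h hn) (hVself m x hm)
  have hclass : ∀ n x, x ∈ V n → {y | ∃ m, x ∈ V m ∧ Q m x y} = {y | Q n x y} := by
    intro n x hx
    ext y
    constructor
    · rintro ⟨m, hm, h⟩
      rwa [hVdisj n m x hx hm]
    · exact fun h => ⟨n, hx, h⟩
  let R : X → X → Prop := fun x y => ∃ n, x ∈ V n ∧ Q n x y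
  refine ⟨R, ⟨?_, ?_, ?_, ?_, ?_⟩, ?_, ?_⟩
  · rintro x y ⟨n, -, h⟩
    exact (hQ n).le _ _ h
  · rintro x y ⟨n, hx, h⟩
    exact ⟨n, hVQ n x y hx h, (hQ n).symm _ _ h⟩
  · rintro x y z ⟨n, hx, h⟩ ⟨m, hy, h'⟩
    obtain rfl := hVdisj n m y (hVQ n x y hx h) hy
    exact ⟨n, hx, (hQ n).trans _ _ _ h h'⟩
  · intro (x : X)
    rcases Classical.em (∃ n, x ∈ V n) with ⟨n, hn⟩ | hx
    · show {y | R x y}.Finite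
      rw [show {y | R x y} = _ from hclass n x hn]
      exact (hQ n).finite x
    · rw [show {y | R x y} = ∅ from ?_]
      · exact finite_empty
      ext y
      simp only [mem_ofPred_eq, mem_empty_iff_false, iff_false]
      rintro ⟨n, hn, -⟩
      exact hx ⟨n, hn⟩
  · have : {p : X × X | ∃ n, p.1 ∈ V n ∧ Q n p.1 p.2} =
        ⋃ n, Prod.fst ⁻¹' V n ∩ {p : X × X | Q n p.1 p.2} := by
      ext p; simp
    rw [this]
    exact .iUnion fun n => (measurable_fst (hnext n _ (hUm n))).inter (hQ n).borel
  · rintro x ⟨n, hx, -⟩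
    rw [show {y | R x y} = _ from hclass n x hx]
    exact hx.1.2
  · intro S hS hne hSE hPS
    obtain ⟨n, hn⟩ := hQS S hS hSE
    by_contra hcon
    push Not at hcon
    have hnotV : ∀ x ∈ S, ∀ m, x ∉ V m := fun x hx m hm =>
      hcon x hx ⟨m, hm, hm.1.1⟩
    have hnotU : ∀ x ∈ S, ∀ m, x ∉ U m := by
      intro x hx m
      induction m with
      | zero => exact fun h => h
      | succ m ih =>
        rintro (h | h)
        · exact ih h
        · exact hnotV x hx m h
    obtain ⟨x, hx⟩ := hne
    refine hnotV x hx n ⟨⟨(hn x hx).1, (hn x hx).2 ▸ hPS⟩, fun y _ hy => ?_⟩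
    exact hnotU y ((hn x hx).2 ▸ hy) n

/-! ### Sizes relative to a cocycle. -/

section Size

variable {ρ : X → X → ℝ}

theorem size_eq_tsum_indicator (z : X) (Y : Set X) :
    size ρ z Y = ∑' y, Y.indicator (fun y => ENNReal.ofReal (ρ y z)) y :=
  tsum_subtype Y fun y => ENNReal.ofReal (ρ y z)

theorem size_mono (z : X) {Y Y' : Set X} (h : Y ⊆ Y') : size ρ z Y ≤ size ρ z Y' := by
  rw [size_eq_tsum_indicator, size_eq_tsum_indicator]
  exact ENNReal.tsum_le_tsum fun y => indicator_le_indicator_of_subset h (fun _ => zero_le) y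

@[simp] theorem size_empty (z : X) : size ρ z ∅ = 0 := by
  simp [size]

theorem size_singleton (z y : X) : size ρ z {y} = ENNReal.ofReal (ρ y z) := by
  simp [size]

theorem size_union (z : X) {Y Y' : Set X} (h : Disjoint Y Y') :
    size ρ z (Y ∪ Y') = size ρ z Y + size ρ z Y' := by
  simp only [size_eq_tsum_indicator, ← ENNReal.tsum_add, indicator_union_of_disjoint h]

theorem size_inter_add_sdiff (z : X) (Y A : Set X) :
    size ρ z (Y ∩ A) + size ρ z (Y \ A) = size ρ z Y := by
  rw [← size_union z disjoint_sdiff_inter.symm, inter_union_sdiff]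

theorem size_lt_top (z : X) {Y : Set X} (h : Y.Finite) : size ρ z Y < ⊤ := by
  induction Y, h using Set.Finite.induction_on with
  | empty => simp
  | insert ha _ ih =>
    rw [insert_eq, size_union z (disjoint_singleton_left.2 ha), size_singleton]
    exact ENNReal.add_lt_top.2 ⟨ENNReal.ofReal_lt_top, ih⟩

variable [MeasurableSpace X] {E : Setoid X}

theorem IsBorelCocycle.self (hρ : IsBorelCocycle E ρ) (x : X) : ρ x x = 1 := by
  have h := hρ.mul x x x (E.refl x) (E.refl x)
  have h' := hρ.pos x x (E.refl x)
  nlinarith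

theorem IsBorelCocycle.mul_swap (hρ : IsBorelCocycle E ρ) {x y : X} (h : E x y) :
    ρ x y * ρ y x = 1 := by
  rw [← hρ.mul x y x h (E.symm h), hρ.self]

theorem size_pos (hρ : IsBorelCocycle E ρ) {z y : X} {Y : Set X} (h : E y z) (hy : y ∈ Y) :
    0 < size ρ z Y := by
  refine lt_of_lt_of_le ?_ (size_mono z (singleton_subset_iff.2 hy))
  rw [size_singleton]
  exact ENNReal.ofReal_pos.2 (hρ.pos y z h)

/-- Change of base point. -/
theorem size_eq_mul (hρ : IsBorelCocycle E ρ) {x z : X} (h : E x z) {Y : Set X}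
    (hY : ∀ y ∈ Y, E y x) : size ρ z Y = ENNReal.ofReal (ρ x z) * size ρ x Y := by
  unfold size
  rw [← ENNReal.tsum_mul_left]
  refine tsum_congr fun y => ?_
  rw [hρ.mul y x z (hY y y.2) h, ENNReal.ofReal_mul (hρ.pos _ _ (hY y y.2)).le, mul_comm]

theorem size_le_mul_size_iff (hρ : IsBorelCocycle E ρ) {x z : X} (h : E x z) {Y Y' : Set X}
    (hY : ∀ y ∈ Y, E y x) (hY' : ∀ y ∈ Y', E y x) (K : ℝ≥0∞) :
    size ρ z Y ≤ K * size ρ z Y' ↔ size ρ x Y ≤ K * size ρ x Y' := by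
  rw [size_eq_mul hρ h hY, size_eq_mul hρ h hY', mul_left_comm]
  exact ENNReal.mul_le_mul_iff_right (ENNReal.ofReal_pos.2 (hρ.pos _ _ h)).ne'
    ENNReal.ofReal_ne_top

theorem size_le_size_iff (hρ : IsBorelCocycle E ρ) {x z : X} (h : E x z) {Y Y' : Set X}
    (hY : ∀ y ∈ Y, E y x) (hY' : ∀ y ∈ Y', E y x) :
    size ρ z Y ≤ size ρ z Y' ↔ size ρ x Y ≤ size ρ x Y' := by
  simpa using size_le_mul_size_iff hρ h hY hY' 1

theorem IsFiniteBorelSub.finite_class {F : Setoid X} (hF : IsFiniteBorelSub F E) (x : X) :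
    {y | F x y}.Finite := by
  convert hF.finite x using 2
  ext y
  exact ⟨fun h => F.symm h, fun h => F.symm h⟩

/-- In an infinite union of `F`-classes of size between `b / 8` and `b`, finite unions of
`F`-classes attain every size up to an error of `b`. -/
theorem exists_finite_invariant_size_between {F : Setoid X} (hF : IsFiniteBorelSub F E) {x : X}
    {Y : Set X} (hYF : ∀ y ∈ Y, ∀ z, F y z → z ∈ Y) (hinf : Y.Infinite) {b t : ℝ≥0∞}
    (hb : b ≠ 0) (ht : t ≠ ⊤) (hY : ∀ y ∈ Y, size ρ x {z | F y z} ≤ b ∧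
      b ≤ 8 * size ρ x {z | F y z}) :
    ∃ T ⊆ Y, T.Finite ∧ (∀ y ∈ T, ∀ z, F y z → z ∈ T) ∧ t ≤ size ρ x T ∧ size ρ x T ≤ t + b := by
  -- Classes are added one at a time. Each adds at least `b / 8`, so `t` is reached, and at most
  -- `b`, so it is not overshot by more.
  have key : ∀ k : ℕ, ∃ T ⊆ Y, T.Finite ∧ (∀ y ∈ T, ∀ z, F y z → z ∈ T) ∧
      ((t ≤ size ρ x T ∧ size ρ x T ≤ t + b) ∨ (size ρ x T < t ∧ k * b ≤ 8 * size ρ x T)) := by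
    intro k
    induction k with
    | zero =>
      refine ⟨∅, empty_subset _, finite_empty, by simp, ?_⟩
      rcases eq_or_ne t 0 with rfl | h
      · exact .inl (by simp)
      · exact .inr (by simpa using pos_iff_ne_zero.2 h)
    | succ k ih =>
      obtain ⟨T, hTY, hTf, hTF, hT | ⟨hT1, hT2⟩⟩ := ih
      · exact ⟨T, hTY, hTf, hTF, .inl hT⟩
      · obtain ⟨y, hyY, hyT⟩ := (hinf.sdiff hTf).nonempty
        have hdisj : Disjoint T {z | F y z} := by
          rw [disjoint_left]
          exact fun z hz hyz => hyT (hTF z hz y (F.symm hyz))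
        have hsz := size_union (ρ := ρ) x hdisj
        refine ⟨T ∪ {z | F y z}, union_subset hTY fun z hz => hYF y hyY z hz,
          hTf.union (hF.finite_class y), ?_, ?_⟩
        · rintro w (hw | hw) z hz
          · exact .inl (hTF w hw z hz)
          · exact .inr (F.trans hw hz)
        · rw [hsz]
          rcases le_or_gt t (size ρ x T + size ρ x {z | F y z}) with h | h
          · exact .inl ⟨h, add_le_add hT1.le (hY y hyY).1⟩
          · refine .inr ⟨h, ?_⟩
            rw [mul_add]
            push_cast
            rw [add_mul, one_mul]
            exact add_le_add hT2 (hY y hyY).2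
  obtain ⟨k, hk⟩ := ENNReal.exists_nat_mul_gt hb (show 8 * t ≠ ⊤ from
    ENNReal.mul_ne_top (by simp) ht)
  obtain ⟨T, hTY, hTf, hTF, hT | ⟨hT1, hT2⟩⟩ := key k
  · exact ⟨T, hTY, hTf, hTF, hT⟩
  · exact absurd (hk.trans_le hT2) (not_lt.2 (mul_le_mul_right hT1.le _))

/-- The hypothesis is summed over the finitely many `F`-classes that make up `T`; the induction
splits off one class. -/
theorem size_le_mul_of_invariant (hρ : IsBorelCocycle E ρ) {F : Setoid X}
    (hF : IsFiniteBorelSub F E) {A : Set X} {K : ℝ≥0∞} {z : X} {T : Set X} (hTf : T.Finite)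
    (hTE : ∀ y ∈ T, E y z) (hTF : ∀ y ∈ T, ∀ w, F y w → w ∈ T)
    (hT : ∀ y ∈ T, size ρ y {w | F y w} ≤ K * size ρ y (A ∩ {w | F y w})) :
    size ρ z T ≤ K * size ρ z (A ∩ T) := by
  induction h : T.ncard using Nat.strong_induction_on generalizing T with
  | _ n ih =>
    rcases T.eq_empty_or_nonempty with rfl | ⟨y, hy⟩
    · simp
    · have hsub : {w | F y w} ⊆ T := fun w hw => hTF y hy w hw
      have hlt : (T \ {w | F y w}).ncard < n := by
        rw [← h]
        exact ncard_lt_ncard ⟨sdiff_subset, fun hcon => (hcon hy).2 (F.refl y)⟩ hTf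
      have h1 := ih _ hlt (T := T \ {w | F y w}) (hTf.subset sdiff_subset)
        (fun w hw => hTE w hw.1) (fun w hw v hv => ⟨hTF w hw.1 v hv, fun hyv =>
          hw.2 (F.trans hyv (F.symm hv))⟩) (fun w hw => hT w hw.1) rfl
      have hcls : ∀ w ∈ {w | F y w}, E w y := fun w hw => E.symm (hF.le hw)
      have h2 := (size_le_mul_size_iff hρ (hTE y hy) hcls
        (fun w hw => hcls w hw.2) K).2 (hT y hy)
      have hd : Disjoint {w | F y w} (T \ {w | F y w}) := disjoint_sdiff_right
      have e1 : size ρ z T = size ρ z {w | F y w} + size ρ z (T \ {w | F y w}) := by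
        rw [← size_union z hd, union_sdiff_cancel hsub]
      have e2 : size ρ z (A ∩ T) =
          size ρ z (A ∩ {w | F y w}) + size ρ z (A ∩ (T \ {w | F y w})) := by
        rw [← size_union z (hd.mono inter_subset_right inter_subset_right),
          ← inter_union_distrib_left, union_sdiff_cancel hsub]
      rw [e1, e2, mul_add]
      exact add_le_add h2 h1

end Size

/-! ### Lacunary sets and smoothness. -/

section Smooth

variable [MeasurableSpace X]

/-- The set is covered by countably many Borel sets that are independent for the digraph
associated with the ratios in `(1 / 2, 2)`. -/
def CountablyLacunary (E : Setoid X) (ρ : X → X → ℝ) (Y : Set X) : Prop :=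
  ∃ V : ℕ → Set X, (∀ n, MeasurableSet (V n)) ∧
    (∀ n, ∀ x ∈ V n, ∀ y ∈ V n, E x y → ρ x y ∈ Ioo (1 / 2 : ℝ) 2 → x = y) ∧ Y ⊆ ⋃ n, V n

theorem CountablyLacunary.of_countable {E : Setoid X} {ρ : X → X → ℝ} {Y : Set X} {ι : Type*}
    [Countable ι] {V : ι → Set X} (hm : ∀ i, MeasurableSet (V i))
    (hV : ∀ i, ∀ x ∈ V i, ∀ y ∈ V i, E x y → ρ x y ∈ Ioo (1 / 2 : ℝ) 2 → x = y)
    (hY : Y ⊆ ⋃ i, V i) : CountablyLacunary E ρ Y := by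
  rcases isEmpty_or_nonempty ι with he | he
  · refine ⟨fun _ => ∅, fun _ => .empty, fun _ x hx => hx.elim, ?_⟩
    rw [iUnion_of_empty] at hY
    exact hY.trans (empty_subset _)
  · obtain ⟨e, he⟩ := exists_surjective_nat ι
    refine ⟨fun n => V (e n), fun n => hm _, fun n => hV _, ?_⟩
    rwa [he.iUnion_comp]

theorem CountablyLacunary.iUnion {E : Setoid X} {ρ : X → X → ℝ} {ι : Type*} [Countable ι]
    {Y : ι → Set X} (h : ∀ i, CountablyLacunary E ρ (Y i)) : CountablyLacunary E ρ (⋃ i, Y i) := by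
  choose V h1 h2 h3 using h
  refine .of_countable (ι := ι × ℕ) (V := fun q => V q.1 q.2) (fun _ => h1 _ _) (fun _ => h2 _ _) ?_
  rw [iUnion_prod']
  exact iUnion_mono h3

theorem CountablyLacunary.mono {E : Setoid X} {ρ : X → X → ℝ} {Y Y' : Set X}
    (h : CountablyLacunary E ρ Y) (hY : Y' ⊆ Y) : CountablyLacunary E ρ Y' := by
  obtain ⟨V, h1, h2, h3⟩ := h
  exact ⟨V, h1, h2, hY.trans h3⟩

theorem CountablyLacunary.isSmooth {E : Setoid X} {ρ : X → X → ℝ} {B : Set X}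
    (h : CountablyLacunary E ρ B) : IsSmooth (restrictRel E B) (restrictCocycle ρ B) := by
  classical
  obtain ⟨V, h1, h2, h3⟩ := h
  have hex : ∀ x : B, ∃ n, x.1 ∈ V n := fun x => mem_iUnion.1 (h3 x.2)
  refine ⟨Ioo (1 / 2) 2, isOpen_Ioo, fun x hx => lt_trans (by norm_num) hx.1, by norm_num,
    fun x => Nat.find (hex x), ?_, ?_⟩
  · exact measurable_find hex fun n => measurable_subtype_coe (h1 n)
  · rintro x y ⟨hne, hE, hU⟩ hc
    refine hne (Subtype.ext ?_)
    have hx := Nat.find_spec (hex x)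
    have hy := Nat.find_spec (hex y)
    rw [← show Nat.find (hex x) = Nat.find (hex y) from hc] at hy
    exact h2 _ _ hx _ hy hE hU

theorem lt_two_mul_of_floor_logb_eq {a b : ℝ} (ha : 0 < a) (hb : 0 < b)
    (h : ⌊Real.logb 2 a⌋ = ⌊Real.logb 2 b⌋) : a < 2 * b := by
  have h1 := Int.lt_floor_add_one (Real.logb 2 a)
  have h2 := Int.floor_le (Real.logb 2 b)
  rw [h] at h1
  have h3 : Real.logb 2 a < Real.logb 2 (2 * b) := by
    rw [Real.logb_mul (by norm_num) hb.ne', Real.logb_self_eq_one (by norm_num)]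
    linarith
  exact (Real.logb_lt_logb_iff (by norm_num) ha (by positivity)).1 h3

variable {E : Setoid X} {γ : ℕ → X → X} {ρ : X → X → ℝ}

/-- The points of `L` which after weighting by `M` are smaller than `x`, by a factor of at
most `8`. -/
def window (E : Setoid X) (ρ : X → X → ℝ) (M : X → ℝ) (L : Set X) (x : X) : Set X :=
  {y | E x y ∧ y ∈ L ∧ ρ y x * M y ≤ M x ∧ M x ≤ 8 * (ρ y x * M y)}

theorem Generates.measurableSet_window (hγ : Generates E γ) (hρ : IsBorelCocycle E ρ) {M : X → ℝ}
    (hM : Measurable M) {L : Set X} (hL : MeasurableSet L) (n : ℕ) :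
    MeasurableSet {x | γ n x ∈ window E ρ M L x} := by
  have hr := (hγ.measurable_cocycle hρ n).mul (hM.comp (hγ.meas n))
  have : {x | γ n x ∈ window E ρ M L x} = γ n ⁻¹' L ∩
      ({x | ρ (γ n x) x * M (γ n x) ≤ M x} ∩ {x | M x ≤ 8 * (ρ (γ n x) x * M (γ n x))}) := by
    ext x
    exact ⟨fun h => h.2, fun h => ⟨hγ.rel n x, h⟩⟩
  rw [this]
  exact (hγ.meas n hL).inter
    ((measurableSet_le hr hM).inter (measurableSet_le hM (hr.const_mul 8)))

/-- A point with finite window is isolated from the rest of its window by a basic open set. Sort `W`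
by this open set and by the dyadic size of `M`: two equivalent points of one part with comparable
weights would lie one in the window of the other, against isolation. The involutions then carry
these parts to the whole saturation. -/
theorem Generates.countablyLacunary_saturation [StandardBorelSpace X] (hγ : Generates E γ) (hρ : IsBorelCocycle E ρ)
    {M : X → ℝ} (hM : Measurable M) (hMpos : ∀ x, 0 < M x) {W : Set X} (hW : MeasurableSet W)
    (hfin : ∀ x ∈ W, (window E ρ M W x).Finite) :
    CountablyLacunary E ρ {x | ∃ y, E x y ∧ y ∈ W} := by
  let _ := upgradeStandardBorel X
  have hbasis := TopologicalSpace.isBasis_countableBasis X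
  have hcb : Countable (TopologicalSpace.countableBasis X) :=
    (TopologicalSpace.countable_countableBasis X).to_subtype
  have hbin : ∀ {f : X → ℝ} (_ : Measurable f) (j : ℤ), MeasurableSet {x | ⌊Real.logb 2 (f x)⌋ = j} :=
    fun hf j => (hf.log.div_const (Real.log 2)).floor (measurableSet_singleton j)
  let W' : TopologicalSpace.countableBasis X → ℤ → Set X := fun U j =>
    {x | x ∈ W ∧ x ∈ U.1 ∧ (∀ y, E x y → ¬ (y ∈ window E ρ M W x ∧ y ∈ U.1 ∧ y ≠ x)) ∧
      ⌊Real.logb 2 (M x)⌋ = j}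
  have hW'm : ∀ U j, MeasurableSet (W' U j) := by
    intro U j
    have hU := (hbasis.isOpen U.2).measurableSet
    refine hW.inter (hU.inter (MeasurableSet.inter ?_ (hbin hM j)))
    refine hγ.measurableSet_forall fun n => MeasurableSet.compl ?_
    exact (hγ.measurableSet_window hρ hM hW n).inter ((hγ.meas n hU).inter
      (measurableSet_eq_fun (hγ.meas n) measurable_id).compl)
  -- A factor 2 from the bin of `M` and a factor 4 from `ρ` account for the 8 in `window`.
  have hW' : ∀ U j, ∀ x ∈ W' U j, ∀ y ∈ W' U j, E x y → ρ y x ∈ Ioo (1 / 4 : ℝ) 4 → x = y := by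
    rintro U j x ⟨hx1, hx2, hx3, hx4⟩ y ⟨hy1, hy2, hy3, hy4⟩ hxy ⟨hr1, hr2⟩
    by_contra hne
    have hMx := hMpos x
    have hMy := hMpos y
    have hb1 := lt_two_mul_of_floor_logb_eq hMx hMy (hx4.trans hy4.symm)
    have hb2 := lt_two_mul_of_floor_logb_eq hMy hMx (hy4.trans hx4.symm)
    have hswap := hρ.mul_swap hxy
    have hpos := hρ.pos x y hxy
    have hpos' := hρ.pos y x (E.symm hxy)
    rcases le_or_gt (ρ y x * M y) (M x) with h | h
    · exact hx3 y hxy ⟨⟨hxy, hy1, h, by nlinarith⟩, hy2, fun h => hne h.symm⟩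
    · refine hy3 x (E.symm hxy) ⟨⟨E.symm hxy, hx1, ?_, ?_⟩, hx2, hne⟩
      · have : ρ x y * M x ≤ ρ x y * (ρ y x * M y) := mul_le_mul_of_nonneg_left h.le hpos.le
        rwa [← mul_assoc, hswap, one_mul] at this
      · have h3 : ρ y x * M y ≤ 8 * M x := by nlinarith
        have : ρ x y * (ρ y x * M y) ≤ ρ x y * (8 * M x) := mul_le_mul_of_nonneg_left h3 hpos.le
        rw [← mul_assoc, hswap, one_mul] at this
        linarith
  refine .of_countable (ι := TopologicalSpace.countableBasis X × ℤ × ℕ × ℤ)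
    (V := fun q => γ q.2.2.1 ⁻¹' W' q.1 q.2.1 ∩
      {x | ⌊Real.logb 2 (ρ (γ q.2.2.1 x) x)⌋ = q.2.2.2}) ?_ ?_ ?_
  · rintro ⟨U, j, n, i⟩
    exact (hγ.meas n (hW'm U j)).inter (hbin (hγ.measurable_cocycle hρ n) i)
  · rintro ⟨U, j, n, i⟩ x ⟨hx1, hx2⟩ y ⟨hy1, hy2⟩ hxy ⟨hr1, hr2⟩
    simp only [mem_preimage, mem_ofPred_eq] at hx1 hx2 hy1 hy2
    have hx := hγ.rel n x
    have hy := hγ.rel n y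
    have hxpos := hρ.pos _ _ (E.symm hx)
    have hypos := hρ.pos _ _ (E.symm hy)
    have hb1 := lt_two_mul_of_floor_logb_eq hxpos hypos (hx2.trans hy2.symm)
    have hb2 := lt_two_mul_of_floor_logb_eq hypos hxpos (hy2.trans hx2.symm)
    have hγE : E (γ n x) (γ n y) := E.trans (E.symm hx) (E.trans hxy hy)
    have e1 : ρ (γ n y) y * ρ y (γ n x) = ρ (γ n y) (γ n x) :=
      (hρ.mul _ _ _ (E.symm hy) (E.trans (E.symm hxy) hx)).symm
    have e2 : ρ (γ n x) x * ρ x y * ρ y (γ n x) = 1 := by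
      rw [← hρ.mul _ _ _ (E.symm hx) hxy]
      exact hρ.mul_swap (E.trans (E.symm hx) hxy)
    have hp := hρ.pos y (γ n x) (E.trans (E.symm hxy) hx)
    have hpx := hρ.pos x y hxy
    have h := hW' U j _ hx1 _ hy1 hγE ?_
    · rw [← hγ.invol n x, h, hγ.invol]
    · rw [← e1]
      -- Here `a * d = 1 / ρ x y` lies in (1/2, 2) and `b` is within a factor 2 of `a`, so `b * d =
      -- ρ (γ n y) (γ n x)` lies in (1/4, 4).
      set a := ρ (γ n x) x
      set b := ρ (γ n y) y
      set c := ρ x y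
      set d := ρ y (γ n x)
      have hab : 0 < a * d := by positivity
      have hcab : c * (a * d) = 1 := by linarith
      have h1 : b * d < 2 * (a * d) := by nlinarith
      have h2 : a * d < 2 * (b * d) := by nlinarith
      constructor <;> nlinarith
  · rintro x ⟨y, hxy, hy⟩
    obtain ⟨n, rfl⟩ := hγ.surj x y hxy
    have hfin' := hfin _ hy
    obtain ⟨U, hU, hyU, hUb⟩ := hbasis.exists_subset_of_mem_open
      (show γ n x ∈ (window E ρ M W (γ n x) \ {γ n x})ᶜ from fun h => h.2 rfl)
      (hfin'.sdiff.isClosed).isOpen_compl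
    refine mem_iUnion.2 ⟨(⟨U, hU⟩, ⌊Real.logb 2 (M (γ n x))⌋, n,
      ⌊Real.logb 2 (ρ (γ n x) x)⌋), ⟨hy, hyU, ?_, rfl⟩, rfl⟩
    rintro z - ⟨hz1, hz2, hz3⟩
    exact hUb hz2 ⟨hz1, hz3⟩

end Smooth

/-! ### Balanced sets. -/

/-- The size of the `F`-class of `x` relative to `x`. -/
noncomputable def classMass (ρ : X → X → ℝ) (F : Setoid X) (x : X) : ℝ := (size ρ x {y | F x y}).toReal

/-- The set is `F`-invariant and its part outside of `A` has between one and three times the size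
of its part inside of `A`. -/
def IsBalanced (ρ : X → X → ℝ) (F : Setoid X) (A T : Set X) : Prop :=
  ∀ x ∈ T, (∀ y, F x y → y ∈ T) ∧ size ρ x (T ∩ A) ≤ size ρ x (T \ A) ∧
    size ρ x (T \ A) ≤ 3 * size ρ x (T ∩ A)

section

variable [MeasurableSpace X] {E : Setoid X} {γ : ℕ → X → X} {ρ : X → X → ℝ} {F : Setoid X}
  {A : Set X}

theorem ofReal_classMass (hF : IsFiniteBorelSub F E) (x : X) :
    ENNReal.ofReal (classMass ρ F x) = size ρ x {y | F x y} :=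
  ENNReal.ofReal_toReal (size_lt_top x (hF.finite_class x)).ne

theorem classMass_pos (hρ : IsBorelCocycle E ρ) (hF : IsFiniteBorelSub F E) (x : X) :
    0 < classMass ρ F x :=
  ENNReal.toReal_pos (size_pos hρ (E.refl x) (F.refl x)).ne' (size_lt_top x (hF.finite_class x)).ne

theorem size_class (hρ : IsBorelCocycle E ρ) (hF : IsFiniteBorelSub F E) {x y : X} (h : E x y) :
    size ρ x {z | F y z} = ENNReal.ofReal (ρ y x * classMass ρ F y) := by
  rw [ENNReal.ofReal_mul (hρ.pos _ _ (E.symm h)).le, ofReal_classMass hF]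
  exact size_eq_mul hρ (E.symm h) fun z hz => E.symm (hF.le hz)

theorem Generates.measurable_classMass [StandardBorelSpace X] (hγ : Generates E γ)
    (hρ : IsBorelCocycle E ρ) (hF : IsFiniteBorelSub F E) : Measurable (classMass ρ F) :=
  (hγ.measurable_size hρ (fun _ _ h => hF.le h)
    fun n => hγ.measurableSet_rel_right hF.borel n).ennreal_toReal

theorem window_invariant (hρ : IsBorelCocycle E ρ) (hF : IsFiniteBorelSub F E) {L : Set X}
    (hL : ∀ x ∈ L, ∀ y, F x y → y ∈ L) {x y z : X}
    (hy : y ∈ window E ρ (classMass ρ F) L x) (hyz : F y z) :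
    z ∈ window E ρ (classMass ρ F) L x := by
  obtain ⟨h1, h2, h3, h4⟩ := hy
  have hxz : E x z := E.trans h1 (hF.le hyz)
  have : ρ z x * classMass ρ F z = ρ y x * classMass ρ F y := by
    have e1 := size_class hρ hF h1
    have e2 := size_class hρ hF hxz
    have e3 : {w | F y w} = {w | F z w} := by
      ext w
      exact ⟨fun h => F.trans (F.symm hyz) h, fun h => F.trans hyz h⟩
    rw [e3, e2, ENNReal.ofReal_eq_ofReal_iff] at e1
    · exact e1
    · exact (mul_pos (hρ.pos _ _ (E.symm hxz)) (classMass_pos hρ hF z)).le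
    · exact (mul_pos (hρ.pos _ _ (E.symm h1)) (classMass_pos hρ hF y)).le
  exact ⟨hxz, hL y h2 z hyz, by rwa [this], by rwa [this]⟩

/-- An infinite window contains finite unions of `F`-classes of approximately any given size. -/
theorem exists_size_between_of_window_infinite (hρ : IsBorelCocycle E ρ)
    (hF : IsFiniteBorelSub F E) {L : Set X} (hL : ∀ x ∈ L, ∀ y, F x y → y ∈ L) {x y : X}
    (hxy : E x y) (hinf : (window E ρ (classMass ρ F) L y).Infinite) {t : ℝ≥0∞} (ht : t ≠ ⊤) :
    ∃ T ⊆ L, T.Finite ∧ (∀ w ∈ T, E x w) ∧ (∀ w ∈ T, ∀ z, F w z → z ∈ T) ∧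
      t ≤ size ρ x T ∧ size ρ x T ≤ t + size ρ x {z | F y z} := by
  obtain ⟨T, hT1, hT2, hT3, hT4, hT5⟩ := exists_finite_invariant_size_between (ρ := ρ) hF (x := x)
    (b := size ρ x {z | F y z})
    (fun w hw z hwz => window_invariant hρ hF hL hw hwz) hinf
    (size_pos hρ (E.symm hxy) (F.refl y)).ne' ht (by
      rintro w ⟨h1, h2, h3, h4⟩
      have hxw : E x w := E.trans hxy h1
      have hp := hρ.pos _ _ (E.symm hxy)
      have e : ρ w x = ρ w y * ρ y x := hρ.mul _ _ _ (E.symm h1) (E.symm hxy)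
      rw [size_class hρ hF hxw, size_class hρ hF hxy]
      constructor
      · refine ENNReal.ofReal_le_ofReal ?_
        rw [e]
        nlinarith
      · rw [show (8 : ℝ≥0∞) = ENNReal.ofReal 8 by simp, ← ENNReal.ofReal_mul (by norm_num)]
        refine ENNReal.ofReal_le_ofReal ?_
        rw [e]
        nlinarith)
  exact ⟨T, fun w hw => (hT1 hw).2.1, hT2, fun w hw => E.trans hxy (hT1 hw).1, hT3, hT4, hT5⟩

/-- A change of base point multiplies both sides of each inequality by the same factor. -/
theorem isBalanced_of_size (hρ : IsBorelCocycle E ρ) {T : Set X} {x : X}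
    (hTE : ∀ y ∈ T, E x y) (hTF : ∀ y ∈ T, ∀ z, F y z → z ∈ T)
    (h1 : size ρ x (T ∩ A) ≤ size ρ x (T \ A)) (h2 : size ρ x (T \ A) ≤ 3 * size ρ x (T ∩ A)) :
    IsBalanced ρ F A T := by
  intro y hy
  have hin : ∀ z ∈ T ∩ A, E z x := fun z hz => E.symm (hTE z hz.1)
  have hout : ∀ z ∈ T \ A, E z x := fun z hz => E.symm (hTE z hz.1)
  exact ⟨hTF y hy, (size_le_size_iff hρ (hTE y hy) hin hout).2 h1,
    (size_le_mul_size_iff hρ (hTE y hy) hout hin 3).2 h2⟩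

/-- Two equivalent points with infinite windows on the two sides of `A` yield a balanced set. -/
theorem exists_isBalanced (hρ : IsBorelCocycle E ρ) (hF : IsFiniteBorelSub F E)
    {L : Set X} (hLA : ∀ x ∈ L ∩ A, ∀ y, F x y → y ∈ L ∩ A)
    (hLN : ∀ x ∈ L \ A, ∀ y, F x y → y ∈ L \ A) {s z : X} (hs : s ∈ L ∩ A) (hz : z ∈ L \ A)
    (hsz : E s z) (hwA : (window E ρ (classMass ρ F) (L ∩ A) s).Infinite)
    (hwN : (window E ρ (classMass ρ F) (L \ A) z).Infinite) :
    ∃ T ⊆ L, T.Finite ∧ T.Nonempty ∧ (∀ x ∈ T, ∀ y ∈ T, E x y) ∧ IsBalanced ρ F A T := by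
  have hfin : ∀ y, size ρ s {w | F y w} ≠ ⊤ := fun y => (size_lt_top s (hF.finite_class y)).ne
  have hpair : ∀ T : Set X, (∀ w ∈ T, E s w) → ∀ x ∈ T, ∀ y ∈ T, E x y :=
    fun T h x hx y hy => E.trans (E.symm (h x hx)) (h y hy)
  have hcF : ∀ y, ∀ w ∈ {w | F y w}, ∀ v, F w v → v ∈ {w | F y w} :=
    fun y w hw v hv => F.trans hw hv
  -- If |[z]| ≤ 2 |[s]|, add to [s] a set off `A` of size between |[s]| and |[s]| + |[z]| ≤ 3 |[s]|.
  -- Otherwise add to [z] a subset of `A` of size between |[z]| / 3 and |[z]| / 3 + |[s]|, which is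
  -- at most |[z]| because |[s]| < |[z]| / 2.
  rcases le_or_gt (size ρ s {w | F z w}) (2 * size ρ s {w | F s w}) with hcase | hcase
  · obtain ⟨T, hTL, hTf, hTE, hTF, ht1, ht2⟩ := exists_size_between_of_window_infinite hρ hF hLN
      hsz hwN (hfin s)
    have hin : ({w | F s w} ∪ T) ∩ A = {w | F s w} := by
      ext w
      constructor
      · rintro ⟨h | h, hA⟩
        · exact h
        · exact absurd hA (hTL h).2
      · exact fun h => ⟨.inl h, (hLA s hs w h).2⟩
    have hout : ({w | F s w} ∪ T) \ A = T := by
      ext w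
      constructor
      · rintro ⟨h | h, hA⟩
        · exact absurd (hLA s hs w h).2 hA
        · exact h
      · exact fun h => ⟨.inr h, (hTL h).2⟩
    have hE : ∀ w ∈ {w | F s w} ∪ T, E s w := by
      rintro w (h | h)
      · exact hF.le h
      · exact hTE w h
    refine ⟨{w | F s w} ∪ T, ?_, (hF.finite_class s).union hTf, ⟨s, .inl (F.refl s)⟩, hpair _ hE,
      isBalanced_of_size hρ hE ?_ ?_ ?_⟩
    · exact union_subset (fun w hw => (hLA s hs w hw).1) fun w hw => (hTL hw).1
    · rintro w (h | h) v hv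
      · exact .inl (hcF s w h v hv)
      · exact .inr (hTF w h v hv)
    · rw [hin, hout]; exact ht1
    · rw [hin, hout]
      calc size ρ s T ≤ size ρ s {w | F s w} + 2 * size ρ s {w | F s w} :=
            ht2.trans (add_le_add_right hcase _)
        _ = 3 * size ρ s {w | F s w} := by ring
  · obtain ⟨T, hTL, hTf, hTE, hTF, ht1, ht2⟩ := exists_size_between_of_window_infinite hρ hF hLA
      (E.refl s) hwA (t := size ρ s {w | F z w} / 3) (ENNReal.div_ne_top (hfin z) (by simp))
    have hin : ({w | F z w} ∪ T) ∩ A = T := by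
      ext w
      constructor
      · rintro ⟨h | h, hA⟩
        · exact absurd hA (hLN z hz w h).2
        · exact h
      · exact fun h => ⟨.inr h, (hTL h).2⟩
    have hout : ({w | F z w} ∪ T) \ A = {w | F z w} := by
      ext w
      constructor
      · rintro ⟨h | h, hA⟩
        · exact h
        · exact absurd (hTL h).2 hA
      · exact fun h => ⟨.inl h, (hLN z hz w h).2⟩
    have hE : ∀ w ∈ {w | F z w} ∪ T, E s w := by
      rintro w (h | h)
      · exact E.trans hsz (hF.le h)
      · exact hTE w h
    refine ⟨{w | F z w} ∪ T, ?_, (hF.finite_class z).union hTf, ⟨z, .inl (F.refl z)⟩, hpair _ hE,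
      isBalanced_of_size hρ hE ?_ ?_ ?_⟩
    · exact union_subset (fun w hw => (hLN z hz w hw).1) fun w hw => (hTL hw).1
    · rintro w (h | h) v hv
      · exact .inl (hcF z w h v hv)
      · exact .inr (hTF w h v hv)
    · rw [hin, hout]
      refine ht2.trans ?_
      generalize size ρ s {w | F z w} = a at *
      generalize hb : size ρ s {w | F s w} = b at *
      have hbt : b ≠ ⊤ := hb ▸ hfin s
      have hat : a ≠ ⊤ := by
        intro h
        rw [h, ENNReal.top_div_of_ne_top (by simp)] at ht1
        exact (size_lt_top s hTf).ne (top_le_iff.1 ht1)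
      lift a to NNReal using hat
      lift b to NNReal using hbt
      rw [show (3 : ℝ≥0∞) = ((3 : NNReal) : ℝ≥0∞) by simp, ← ENNReal.coe_div (by norm_num)]
      have hcase' : (2 : NNReal) * b < a := by exact_mod_cast hcase
      have : a / 3 + b ≤ a := by
        rw [← NNReal.coe_le_coe]
        rw [← NNReal.coe_lt_coe] at hcase'
        push_cast at *
        linarith [a.coe_nonneg]
      exact_mod_cast this
    · rw [hin, hout]
      exact (ENNReal.div_le_iff' (by simp) (by simp)).1 ht1

variable [StandardBorelSpace X]

theorem Generates.measurableSet_isBalanced (hγ : Generates E γ) (hρ : IsBorelCocycle E ρ)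
    (hF : IsFiniteBorelSub F E) (hA : MeasurableSet A) {R : X → X → Prop}
    (hR : IsPartialFiniteBorel E R) :
    MeasurableSet {x | R x x ∧ IsBalanced ρ F A {y | R x y}} := by
  have hin : Measurable fun x => size ρ x {y | R x y ∧ y ∈ A} :=
    hγ.measurable_size hρ (fun x y h => hR.le _ _ h.1) fun n =>
      (hγ.measurableSet_rel_right hR.borel n).inter (hγ.meas n hA)
  have hout : Measurable fun x => size ρ x {y | R x y ∧ y ∉ A} :=
    hγ.measurable_size hρ (fun x y h => hR.le _ _ h.1) fun n =>
      (hγ.measurableSet_rel_right hR.borel n).inter (hγ.meas n hA.compl)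
  have hinv : MeasurableSet {x | ∀ y, E x y → (R x y → ∀ z, E x z → (F y z → R x z))} := by
    refine hγ.measurableSet_forall fun n => ?_
    have : MeasurableSet {x | ∀ z, E x z → (F (γ n x) z → R x z)} := by
      refine hγ.measurableSet_forall fun m => ?_
      have h1 := (hγ.measurableSet_rel hF.borel n m).compl.union
        (hγ.measurableSet_rel_right hR.borel m)
      convert h1 using 1
      ext x
      simp [imp_iff_not_or]
    convert (hγ.measurableSet_rel_right hR.borel n).compl.union this using 1
    ext x
    simp [imp_iff_not_or]
  have hx : MeasurableSet {x | R x x} :=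
    (measurable_id.prodMk measurable_id) hR.borel
  have := hx.inter (hinv.inter ((measurableSet_le hin hout).inter
    (measurableSet_le hout (hin.const_mul 3))))
  convert this using 1
  ext x
  constructor
  · rintro ⟨h1, h2⟩
    refine ⟨h1, fun y _ hxy z _ hyz => (h2 y hxy).1 z hyz, (h2 x h1).2⟩
  · rintro ⟨h1, h2, h3, h4⟩
    exact ⟨h1, isBalanced_of_size hρ (fun y hy => hR.le _ _ hy)
      (fun y hy z hz => h2 y (hR.le _ _ hy) hy z (E.trans (hR.le _ _ hy) (hF.le hz)) hz) h3 h4⟩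

/-- In a maximal family, two equivalent leftover points on opposite sides of `A` cannot both have
infinite windows, since `exists_isBalanced` would produce another member. So the class meets the set
of leftover points with finite window on one of the sides, and
`Generates.countablyLacunary_saturation` covers it. -/
theorem Generates.exists_balanced_family (hγ : Generates E γ) (hρ : IsBorelCocycle E ρ)
    (hF : IsFiniteBorelSub F E) (hA : MeasurableSet A) (hAF : ∀ x ∈ A, ∀ y, F x y → y ∈ A) :
    ∃ R, IsPartialFiniteBorel E R ∧ (∀ x, R x x → IsBalanced ρ F A {y | R x y}) ∧
      CountablyLacunary E ρ {x | (∃ y, E x y ∧ y ∈ A ∧ ¬ R y y) ∧ ∃ y, E x y ∧ y ∉ A ∧ ¬ R y y} := by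
  obtain ⟨R, hR, hRb, hmax⟩ := hγ.exists_maximal_family (IsBalanced ρ F A)
    fun R hR => hγ.measurableSet_isBalanced hρ hF hA hR
  refine ⟨R, hR, hRb, ?_⟩
  let L : Set X := {x | ¬ R x x}
  have hLm : MeasurableSet L := ((measurable_id.prodMk measurable_id) hR.borel).compl
  have hLF : ∀ x ∈ L, ∀ y, F x y → y ∈ L := by
    intro x hx y hxy hy
    have := (hRb y hy y hy).1 x (F.symm hxy)
    exact hx (hR.refl_left (hR.symm _ _ this))
  have hLA : ∀ x ∈ L ∩ A, ∀ y, F x y → y ∈ L ∩ A :=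
    fun x hx y hxy => ⟨hLF x hx.1 y hxy, hAF x hx.2 y hxy⟩
  have hLN : ∀ x ∈ L \ A, ∀ y, F x y → y ∈ L \ A :=
    fun x hx y hxy => ⟨hLF x hx.1 y hxy, fun hy => hx.2 (hAF y hy x (F.symm hxy))⟩
  have hM := hγ.measurable_classMass hρ hF
  have key : ∀ L' : Set X, MeasurableSet L' → CountablyLacunary E ρ
      {x | ∃ y, E x y ∧ y ∈ {y | y ∈ L' ∧ (window E ρ (classMass ρ F) L' y).Finite}} := by
    intro L' hL'
    refine hγ.countablyLacunary_saturation hρ hM (classMass_pos hρ hF) ?_ ?_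
    · exact hL'.inter (hγ.measurableSet_finite (R := fun x y => y ∈ window E ρ (classMass ρ F) L' x)
        (fun x y h => h.1) fun n => hγ.measurableSet_window hρ hM hL' n)
    · rintro x ⟨-, hx⟩
      exact hx.subset fun y hy => ⟨hy.1, hy.2.1.1, hy.2.2⟩
  have h1 := key _ (hLm.inter hA)
  have h2 := key _ (hLm.diff hA)
  refine (CountablyLacunary.iUnion (ι := Bool) (Y := fun c => cond c _ _) (by
    rintro (_ | _)
    · exact h1
    · exact h2)).mono ?_
  rintro x ⟨⟨s, hxs, hsA, hsR⟩, z, hxz, hzA, hzR⟩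
  rw [mem_iUnion]
  by_cases hfA : (window E ρ (classMass ρ F) (L ∩ A) s).Finite
  · exact ⟨false, s, hxs, ⟨hsR, hsA⟩, hfA⟩
  by_cases hfN : (window E ρ (classMass ρ F) (L \ A) z).Finite
  · exact ⟨true, z, hxz, ⟨hzR, hzA⟩, hfN⟩
  obtain ⟨T, hTL, hTf, hTne, hTE, hTb⟩ := exists_isBalanced hρ hF hLA hLN ⟨hsR, hsA⟩ ⟨hzR, hzA⟩
    (E.trans (E.symm hxs) hxz) hfA hfN
  obtain ⟨y, hy, hyR⟩ := hmax T hTf hTne hTE hTb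
  exact absurd hyR (hTL hy)

end

/-! ### Restriction to invariant sets, as pullback along an injection. -/

section Comap

variable {Y : Type*} {f : Y → X} {ρ : X → X → ℝ}

theorem size_comap (hf : Function.Injective f) (z : Y) {S : Set X} (hS : S ⊆ range f) :
    size (fun a b => ρ (f a) (f b)) z (f ⁻¹' S) = size ρ (f z) S := by
  let g : f ⁻¹' S → S := fun y => ⟨f y, y.2⟩
  have hg : Function.Bijective g := by
    constructor
    · intro a b h
      exact Subtype.ext (hf (congrArg Subtype.val h))
    · rintro ⟨x, hx⟩
      obtain ⟨y, rfl⟩ := hS hx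
      exact ⟨⟨y, hx⟩, rfl⟩
  exact (Equiv.ofBijective g hg).tsum_eq fun y : S => ENNReal.ofReal (ρ y (f z))

variable [MeasurableSpace X] [MeasurableSpace Y] {E F : Setoid X}

theorem IsFiniteBorelSub.comap (hF : IsFiniteBorelSub F E) (hf : Measurable f)
    (hinj : Function.Injective f) : IsFiniteBorelSub (F.comap f) (E.comap f) where
  le := fun _ _ h => hF.le h
  finite := fun x => (hF.finite (f x)).preimage hinj.injOn
  borel := ((hf.comp measurable_fst).prodMk (hf.comp measurable_snd)) hF.borel

theorem IsBorelCocycle.comap (hρ : IsBorelCocycle E ρ) (hf : Measurable f) :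
    IsBorelCocycle (E.comap f) fun a b => ρ (f a) (f b) where
  pos := fun _ _ h => hρ.pos _ _ h
  mul := fun _ _ _ h h' => hρ.mul _ _ _ h h'
  borel := by
    have h : Measurable fun p : {p : Y × Y // E.comap f p.1 p.2} =>
        (⟨(f p.1.1, f p.1.2), p.2⟩ : {p : X × X // E p.1 p.2}) :=
      ((hf.comp (measurable_fst.comp measurable_subtype_coe)).prodMk
        (hf.comp (measurable_snd.comp measurable_subtype_coe))).subtype_mk
    exact hρ.borel.comp h

theorem hasDensityAtLeast_comap (hF : IsFiniteBorelSub F E) (hf : Measurable f)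
    (hinj : Function.Injective f) (hrange : ∀ x ∈ range f, ∀ y, F x y → y ∈ range f) {A : Set X}
    {ε : ℝ} (h : ∀ y, ENNReal.ofReal ε ≤
      relSize ρ (f y) (A ∩ {z | F (f y) z}) {z | F (f y) z}) :
    HasDensityAtLeast (E.comap f) (fun a b => ρ (f a) (f b)) (f ⁻¹' A) ε := by
  refine ⟨F.comap f, hF.comap hf hinj, fun y => ?_⟩
  have hsub : {z | F (f y) z} ⊆ range f := fun z hz => hrange _ (mem_range_self y) z hz
  have e : {z | F.comap f z y} = f ⁻¹' {z | F (f y) z} := by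
    ext z
    exact ⟨fun h => F.symm h, fun h => F.symm h⟩
  rw [e, ← preimage_inter]
  unfold relSize
  rw [size_comap hinj y hsub, size_comap hinj y (inter_subset_right.trans hsub)]
  exact h y

end Comap

/-! ### The stages of the exhaustion. -/

/-- Increasing finite Borel subequivalence relations `F n` and `F n`-invariant Borel sets `A n`,
such that every `F (n + 1)`-class in `A (n + 1)` lies for the larger part outside of `A n`. -/
structure IsStageSequence [MeasurableSpace X] (E : Setoid X) (ρ : X → X → ℝ)
    (F : ℕ → Setoid X) (A : ℕ → Set X) : Prop where
  sub : ∀ n, IsFiniteBorelSub (F n) E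
  meas : ∀ n, MeasurableSet (A n)
  inv : ∀ n, ∀ x ∈ A n, ∀ y, F n x y → y ∈ A n
  mono : ∀ n, F n ≤ F (n + 1)
  zero : ∀ x y, F 0 x y → x = y
  out : ∀ n, ∀ x ∉ A (n + 1), ∀ y, F (n + 1) x y → F n x y
  le : ∀ n, ∀ x ∈ A (n + 1),
    size ρ x ({y | F (n + 1) x y} ∩ A n) ≤ size ρ x ({y | F (n + 1) x y} \ A n)

/-- Each `F`-class in `A` has at most `K` times the size of its intersection with `S`. -/
def IsDenseIn (ρ : X → X → ℝ) (F : Setoid X) (S A : Set X) (K : ℝ≥0∞) : Prop :=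
  ∀ x ∈ A, size ρ x {y | F x y} ≤ K * size ρ x (S ∩ {y | F x y})

/-- The members of a maximal balanced family become classes and `F` is kept elsewhere. For a member
`T`, balance gives |T| ≤ 4 |T ∩ A|, and `T ∩ A` is a union of `F`-classes to which the bound with
`K` applies; hence `4 * K`. -/
theorem Generates.exists_next_stage [MeasurableSpace X] [StandardBorelSpace X] {E : Setoid X}
    {γ : ℕ → X → X} {ρ : X → X → ℝ} (hγ : Generates E γ) (hρ : IsBorelCocycle E ρ) {F : Setoid X}
    {A S : Set X} {K : ℝ≥0∞} (hF : IsFiniteBorelSub F E) (hA : MeasurableSet A)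
    (hAF : ∀ x ∈ A, ∀ y, F x y → y ∈ A) (hd : IsDenseIn ρ F S A K) :
    ∃ (F' : Setoid X) (A' : Set X), IsFiniteBorelSub F' E ∧ MeasurableSet A' ∧
      (∀ x ∈ A', ∀ y, F' x y → y ∈ A') ∧ F ≤ F' ∧ (∀ x ∉ A', ∀ y, F' x y → F x y) ∧
      (∀ x ∈ A', size ρ x ({y | F' x y} ∩ A) ≤ size ρ x ({y | F' x y} \ A)) ∧
      IsDenseIn ρ F' S A' (4 * K) ∧
      CountablyLacunary E ρ
        {x | (∃ y, E x y ∧ y ∈ A ∧ y ∉ A') ∧ ∃ y, E x y ∧ y ∉ A ∧ y ∉ A'} := by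
  obtain ⟨R, hR, hRb, hL⟩ := hγ.exists_balanced_family hρ hF hA hAF
  have hFR : ∀ x y, F x y → R x x → R x y := fun x y h hx => (hRb x hx x hx).1 y h
  let F' : Setoid X :=
    { r := fun x y => R x y ∨ (¬ R x x ∧ ¬ R y y ∧ F x y)
      iseqv := by
        refine ⟨fun x => ?_, ?_, ?_⟩
        · by_cases h : R x x
          · exact .inl h
          · exact .inr ⟨h, h, F.refl x⟩
        · rintro x y (h | ⟨h1, h2, h3⟩)
          · exact .inl (hR.symm _ _ h)
          · exact .inr ⟨h2, h1, F.symm h3⟩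
        · rintro x y z (h | ⟨h1, h2, h3⟩) (h' | ⟨h1', h2', h3'⟩)
          · exact .inl (hR.trans _ _ _ h h')
          · exact absurd (hR.refl_left (hR.symm _ _ h)) h1'
          · exact absurd (hR.refl_left h') h2
          · exact .inr ⟨h1, h2', F.trans h3 h3'⟩ }
  have hF'def : ∀ x y, F' x y ↔ R x y ∨ (¬ R x x ∧ ¬ R y y ∧ F x y) := fun _ _ => Iff.rfl
  have hcls : ∀ x, R x x → {y | F' x y} = {y | R x y} := by
    intro x hx
    ext y
    exact ⟨fun h => h.resolve_right fun h => h.1 hx, fun h => .inl h⟩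
  have hdiag : MeasurableSet {x | R x x} := (measurable_id.prodMk measurable_id) hR.borel
  refine ⟨F', {x | R x x}, ⟨?_, ?_, ?_⟩, hdiag, ?_, ?_, ?_, ?_, ?_, hL⟩
  · rintro x y (h | ⟨-, -, h⟩)
    · exact hR.le _ _ h
    · exact hF.le h
  · intro x
    refine ((hR.finite x).union (hF.finite x)).subset ?_
    rintro y (h | ⟨-, -, h⟩)
    · exact .inl (hR.symm _ _ h)
    · exact .inr h
  · exact hR.borel.union ((measurable_fst hdiag).compl.inter
      ((measurable_snd hdiag).compl.inter hF.borel))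
  · intro x hx y hxy
    rw [hF'def] at hxy
    rcases hxy with h | h
    · exact hR.refl_left (hR.symm _ _ h)
    · exact absurd hx h.1
  · intro x y h
    by_cases hx : R x x
    · exact .inl (hFR x y h hx)
    · exact .inr ⟨hx, fun hy => hx (hR.refl_left (hR.symm _ _ (hFR y x (F.symm h) hy))), h⟩
  · intro x hx y hxy
    rcases (hF'def x y).1 hxy with h | h
    · exact absurd (hR.refl_left h) hx
    · exact h.2.2
  · intro x hx
    rw [hcls x hx]
    exact (hRb x hx x hx).2.1
  · intro x hx
    have hT := hRb x hx
    rw [hcls x hx, ← size_inter_add_sdiff x {y | R x y} A]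
    have h1 : size ρ x ({y | R x y} ∩ A) ≤ K * size ρ x (S ∩ ({y | R x y} ∩ A)) := by
      refine size_le_mul_of_invariant hρ hF ((hR.finite x).subset inter_subset_left)
        (fun y hy => E.symm (hR.le _ _ hy.1))
        (fun y hy z hz => ⟨(hT y hy.1).1 z hz, hAF y hy.2 z hz⟩) (fun y hy => hd y hy.2)
    calc size ρ x ({y | R x y} ∩ A) + size ρ x ({y | R x y} \ A)
        ≤ size ρ x ({y | R x y} ∩ A) + 3 * size ρ x ({y | R x y} ∩ A) :=
          add_le_add_right (hT x hx).2.2 _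
      _ = 4 * size ρ x ({y | R x y} ∩ A) := by ring
      _ ≤ 4 * (K * size ρ x (S ∩ ({y | R x y} ∩ A))) := mul_le_mul_right h1 _
      _ ≤ 4 * (K * size ρ x (S ∩ {y | R x y})) :=
          mul_le_mul_right (mul_le_mul_right
            (size_mono x (inter_subset_inter_right _ inter_subset_left)) _) _
      _ = 4 * K * size ρ x (S ∩ {y | R x y}) := by ring

theorem isFiniteBorelSub_bot [MeasurableSpace X] [StandardBorelSpace X] (E : Setoid X) :
    IsFiniteBorelSub ⊥ E where
  le := bot_le
  finite := fun x => (finite_singleton x).subset fun y (hy : y = x) => hy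
  borel := measurableSet_eq_fun measurable_fst measurable_snd

theorem Generates.exists_isStageSequence [MeasurableSpace X] [StandardBorelSpace X] {E : Setoid X}
    {γ : ℕ → X → X} {ρ : X → X → ℝ} (hγ : Generates E γ) (hρ : IsBorelCocycle E ρ) {S : Set X}
    (hS : MeasurableSet S) :
    ∃ (F : ℕ → Setoid X) (A : ℕ → Set X), IsStageSequence E ρ F A ∧ A 0 = S ∧
      (∀ n, IsDenseIn ρ (F n) S (A n) (4 ^ n)) ∧
      ∀ n, CountablyLacunary E ρ
        {x | (∃ y, E x y ∧ y ∈ A n ∧ y ∉ A (n + 1)) ∧ ∃ y, E x y ∧ y ∉ A n ∧ y ∉ A (n + 1)} := by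
  let St := {q : Setoid X × Set X × ℝ≥0∞ // IsFiniteBorelSub q.1 E ∧ MeasurableSet q.2.1 ∧
    (∀ x ∈ q.2.1, ∀ y, q.1 x y → y ∈ q.2.1) ∧ IsDenseIn ρ q.1 S q.2.1 q.2.2}
  have hnext : ∀ q : St, ∃ q' : St, q'.1.2.2 = 4 * q.1.2.2 ∧ q.1.1 ≤ q'.1.1 ∧
      (∀ x ∉ q'.1.2.1, ∀ y, q'.1.1 x y → q.1.1 x y) ∧
      (∀ x ∈ q'.1.2.1, size ρ x ({y | q'.1.1 x y} ∩ q.1.2.1) ≤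
        size ρ x ({y | q'.1.1 x y} \ q.1.2.1)) ∧
      CountablyLacunary E ρ {x | (∃ y, E x y ∧ y ∈ q.1.2.1 ∧ y ∉ q'.1.2.1) ∧
        ∃ y, E x y ∧ y ∉ q.1.2.1 ∧ y ∉ q'.1.2.1} := by
    rintro ⟨⟨F, A, K⟩, h1, h2, h3, h4⟩
    obtain ⟨F', A', i1, i2, i3, i4, i5, i6, i7, i8⟩ := hγ.exists_next_stage hρ h1 h2 h3 h4
    exact ⟨⟨⟨F', A', 4 * K⟩, i1, i2, i3, i7⟩, rfl, i4, i5, i6, i8⟩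
  choose next h1 h2 h3 h4 h5 using hnext
  let q₀ : St := ⟨⟨⊥, S, 1⟩, isFiniteBorelSub_bot E, hS,
    fun x hx y (hy : x = y) => hy ▸ hx, fun x hx => by
      rw [one_mul]
      exact size_mono x fun y (hy : x = y) => ⟨hy ▸ hx, hy⟩⟩
  let s : ℕ → St := fun n => Nat.rec q₀ (fun _ q => next q) n
  have hK : ∀ n, (s n).1.2.2 = 4 ^ n := by
    intro n
    induction n with
    | zero => rfl
    | succ n ih => exact (h1 (s n)).trans (by rw [ih, pow_succ, mul_comm])
  refine ⟨fun n => (s n).1.1, fun n => (s n).1.2.1, ⟨fun n => (s n).2.1, fun n => (s n).2.2.1,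
    fun n => (s n).2.2.2.1, fun n => h2 (s n), fun x y h => h, fun n => h3 (s n),
    fun n => h4 (s n)⟩, rfl, fun n => hK n ▸ (s n).2.2.2.2, fun n => h5 (s n)⟩

/-- An invariant range contains the whole class of each of its points, so the pullback does not
change the sizes in `le`. -/
theorem IsStageSequence.comap [MeasurableSpace X] {E : Setoid X} {ρ : X → X → ℝ}
    {F : ℕ → Setoid X} {A : ℕ → Set X} (h : IsStageSequence E ρ F A) {Y : Type*}
    [MeasurableSpace Y] {f : Y → X} (hf : Measurable f) (hinj : Function.Injective f)
    (hrange : ∀ x ∈ range f, ∀ y, E x y → y ∈ range f) :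
    IsStageSequence (E.comap f) (fun a b => ρ (f a) (f b)) (fun n => (F n).comap f)
      (fun n => f ⁻¹' A n) where
  sub := fun n => (h.sub n).comap hf hinj
  meas := fun n => hf (h.meas n)
  inv := fun n x hx y hxy => h.inv n _ hx _ hxy
  mono := fun n _ _ hxy => h.mono n hxy
  zero := fun x y hxy => hinj (h.zero _ _ hxy)
  out := fun n x hx y hxy => h.out n _ hx _ hxy
  le := by
    intro n x hx
    have hsub : {y | F (n + 1) (f x) y} ⊆ range f := fun y hy =>
      hrange _ (mem_range_self x) y ((h.sub (n + 1)).le hy)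
    have e1 := size_comap (ρ := ρ) hinj x (inter_subset_left.trans hsub :
      {y | F (n + 1) (f x) y} ∩ A n ⊆ range f)
    have e2 := size_comap (ρ := ρ) hinj x (sdiff_subset.trans hsub :
      {y | F (n + 1) (f x) y} \ A n ⊆ range f)
    have := h.le n (f x) hx
    rw [← e1, ← e2] at this
    exact this

theorem hasPositiveDensity_of_isDenseIn [MeasurableSpace X] {E F : Setoid X} {ρ : X → X → ℝ}
    (hρ : IsBorelCocycle E ρ) {Y : Type*} [MeasurableSpace Y] {f : Y → X} (hf : Measurable f)
    (hinj : Function.Injective f) (hrange : ∀ x ∈ range f, ∀ y, E x y → y ∈ range f)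
    (hF : IsFiniteBorelSub F E) {S : Set X} {K : ℕ} (hK : K ≠ 0)
    (hd : IsDenseIn ρ F S (range f) K) :
    HasPositiveDensity (E.comap f) (fun a b => ρ (f a) (f b)) (f ⁻¹' S) := by
  have hKpos : (0 : ℝ) < K := by positivity
  refine ⟨(K : ℝ)⁻¹, by positivity, hasDensityAtLeast_comap hF hf hinj
    (fun x hx y hxy => hrange x hx y (hF.le hxy)) fun y => ?_⟩
  have hpos : size ρ (f y) {z | F (f y) z} ≠ 0 :=
    (size_pos hρ (E.refl (f y)) (F.refl (f y))).ne'
  have hfin := (size_lt_top (ρ := ρ) (f y) (hF.finite_class (f y))).ne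
  rw [relSize, ENNReal.le_div_iff_mul_le (.inl hpos) (.inl hfin), ENNReal.ofReal_inv_of_pos hKpos,
    ENNReal.ofReal_natCast]
  rw [ENNReal.inv_mul_le_iff (by simpa using hK) (by simp)]
  exact hd (f y) (mem_range_self y)

/-! ### Levels and the compression of the quotient. -/

theorem tsum_size_toClass (G : Setoid X) (ρ : X → X → ℝ) (z : X) (U : Set (Quotient G)) :
    ∑' a : U, size ρ z (toClass G a) = size ρ z (Quotient.mk G ⁻¹' U) := by
  classical
  rw [tsum_subtype U fun a => size ρ z (toClass G a)]
  have h1 : ∀ a, U.indicator (fun a => size ρ z (toClass G a)) a =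
      ∑' x, if a = Quotient.mk G x then
        (Quotient.mk G ⁻¹' U).indicator (fun x => ENNReal.ofReal (ρ x z)) x else 0 := by
    intro a
    by_cases ha : a ∈ U
    · rw [indicator_of_mem ha, size_eq_tsum_indicator]
      refine tsum_congr fun x => ?_
      by_cases hx : a = Quotient.mk G x
      · rw [if_pos hx, indicator_of_mem (show x ∈ toClass G a from hx.symm),
          indicator_of_mem (show x ∈ Quotient.mk G ⁻¹' U from show _ ∈ U from hx ▸ ha)]
      · rw [if_neg hx, indicator_of_notMem (show x ∉ toClass G a from fun h => hx h.symm)]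
    · rw [indicator_of_notMem ha, eq_comm, ENNReal.tsum_eq_zero]
      intro x
      split_ifs with hx
      · subst hx
        exact indicator_of_notMem (show x ∉ Quotient.mk G ⁻¹' U from ha) _
      · rfl
  simp_rw [h1]
  rw [ENNReal.tsum_comm, size_eq_tsum_indicator]
  exact tsum_congr fun x => tsum_ite_eq (Quotient.mk G x) _

/-- The points that enter `A` at time `n`. -/
def level (A : ℕ → Set X) (n : ℕ) : Set X := {x | x ∈ A n ∧ ∀ k < n, x ∉ A k}

theorem level_unique {A : ℕ → Set X} {x : X} {m n : ℕ} (hm : x ∈ level A m) (hn : x ∈ level A n) : m = n := by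
  rcases lt_trichotomy m n with h | h | h
  · exact absurd hm.1 (hn.2 m h)
  · exact h
  · exact absurd hn.1 (hm.2 n h)

theorem exists_level_or (A : ℕ → Set X) (x : X) : (∃ n, x ∈ level A n) ∨ ∀ n, x ∉ A n := by
  classical
  by_cases h : ∃ n, x ∈ A n
  · exact .inl ⟨Nat.find h, Nat.find_spec h, fun k hk => Nat.find_min h hk⟩
  · exact .inr (not_exists.1 h)

/-- Points are related if they are equal or `F n`-related points of the same level `n`. -/
def levelRel (F : ℕ → Setoid X) (A : ℕ → Set X) : Setoid X where
  r x y := x = y ∨ ∃ n, x ∈ level A n ∧ y ∈ level A n ∧ F n x y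
  iseqv := by
    refine ⟨fun x => .inl rfl, ?_, ?_⟩
    · rintro x y (rfl | ⟨n, h1, h2, h3⟩)
      · exact .inl rfl
      · exact .inr ⟨n, h2, h1, (F n).symm h3⟩
    · rintro x y z (rfl | ⟨n, h1, h2, h3⟩) (rfl | ⟨m, h1', h2', h3'⟩)
      · exact .inl rfl
      · exact .inr ⟨m, h1', h2', h3'⟩
      · exact .inr ⟨n, h1, h2, h3⟩
      · obtain rfl := level_unique h2 h1'
        exact .inr ⟨n, h1, h2', (F n).trans h3 h3'⟩

theorem levelRel_iff {F : ℕ → Setoid X} {A : ℕ → Set X} {x y : X} :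
    levelRel F A x y ↔ x = y ∨ ∃ n, x ∈ level A n ∧ y ∈ level A n ∧ F n x y := Iff.rfl

section

variable [MeasurableSpace X] {E : Setoid X} {ρ : X → X → ℝ}

/-- The quotient cocycle is computed at the representative `b.out`; moving to `y` multiplies
numerator and denominator by the same factor. Its real value loses nothing, as classes have finite
and positive size. -/
theorem size_quotientCocycle (hρ : IsBorelCocycle E ρ) {G : Setoid X} (hG : IsFiniteBorelSub G E)
    (y : X) {U : Set (Quotient G)} (hU : ∀ x, Quotient.mk G x ∈ U → E x y) :
    size (quotientCocycle G ρ) (Quotient.mk G y) U =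
      relSize ρ y (Quotient.mk G ⁻¹' U) {z | G y z} := by
  set b := Quotient.mk G y
  have hb : G b.out y := Quotient.exact (Quotient.out_eq b)
  have hbE : E b.out y := hG.le hb
  have hcls : toClass G b = {z | G y z} := by
    ext z
    exact ⟨fun h => G.symm (Quotient.exact h), fun h => Quotient.sound (G.symm h)⟩
  have hden : size ρ b.out {z | G y z} ≠ 0 :=
    (size_pos hρ (E.symm hbE) (G.refl y)).ne'
  have h1 : ∀ a : Quotient G, ENNReal.ofReal (quotientCocycle G ρ a b) =
      size ρ b.out (toClass G a) / size ρ b.out {z | G y z} := by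
    intro a
    unfold quotientCocycle relSize
    rw [hcls, ENNReal.ofReal_toReal]
    refine ENNReal.div_ne_top (size_lt_top _ ?_).ne hden
    induction a using Quotient.inductionOn with
    | _ x =>
      refine (hG.finite_class x).subset fun z hz => ?_
      exact G.symm (Quotient.exact hz)
  have h2 : size (quotientCocycle G ρ) b U =
      relSize ρ b.out (Quotient.mk G ⁻¹' U) {z | G y z} := by
    unfold relSize
    rw [← tsum_size_toClass, ENNReal.div_eq_inv_mul, ← ENNReal.tsum_mul_left]
    unfold size
    refine tsum_congr fun a => ?_
    rw [h1, ENNReal.div_eq_inv_mul]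
    rfl
  rw [h2]
  unfold relSize
  rw [size_eq_mul hρ (E.symm hbE) (Y := Quotient.mk G ⁻¹' U) (fun x hx => hU x hx),
    size_eq_mul hρ (E.symm hbE) (Y := {z | G y z}) (fun z hz => E.symm (hG.le hz))]
  exact ENNReal.mul_div_mul_left _ _ (ENNReal.ofReal_pos.2 (hρ.pos _ _ (E.symm hbE))).ne'
    ENNReal.ofReal_ne_top

variable {F : ℕ → Setoid X} {A : ℕ → Set X}

theorem measurableSet_level (hA : ∀ n, MeasurableSet (A n)) (n : ℕ) :
    MeasurableSet (level A n) := by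
  have : level A n = A n ∩ ⋂ k ∈ Finset.range n, (A k)ᶜ := by
    ext x; simp [level]
  rw [this]
  exact (hA n).inter (Finset.measurableSet_biInter _ fun k _ => (hA k).compl)

theorem IsStageSequence.isFiniteBorelSub_levelRel [StandardBorelSpace X]
    (h : IsStageSequence E ρ F A) : IsFiniteBorelSub (levelRel F A) E where
  le := by
    rintro x y (rfl | ⟨n, -, -, hxy⟩)
    · exact E.refl x
    · exact (h.sub n).le hxy
  finite := by
    intro x
    rcases exists_level_or A x with ⟨n, hn⟩ | hx
    · refine ((h.sub n).finite x).subset ?_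
      rintro y (rfl | ⟨m, -, hm, hxy⟩)
      · exact (F n).refl y
      · rwa [level_unique hn hm]
    · refine (finite_singleton x).subset ?_
      rintro y (rfl | ⟨m, -, hm, -⟩)
      · rfl
      · exact absurd hm.1 (hx m)
  borel := by
    have : {p : X × X | levelRel F A p.1 p.2} = {p | p.1 = p.2} ∪
        ⋃ n, (Prod.fst ⁻¹' level A n) ∩ ((Prod.snd ⁻¹' level A n) ∩ {p | F n p.1 p.2}) := by
      ext p
      simp [levelRel_iff]
    unfold IsBorelRel
    rw [this]
    exact (measurableSet_eq_fun measurable_fst measurable_snd).union <| .iUnion fun n =>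
      (measurable_fst (measurableSet_level h.meas n)).inter
        ((measurable_snd (measurableSet_level h.meas n)).inter (h.sub n).borel)

/-- There is a Borel map that sends each level into the next one. -/
theorem IsStageSequence.exists_shift [StandardBorelSpace X] {γ : ℕ → X → X} (hγ : Generates E γ)
    (hρ : IsBorelCocycle E ρ) (h : IsStageSequence E ρ F A) (hmono : ∀ n, A n ⊆ A (n + 1)) :
    ∃ g : X → X, Measurable g ∧
      (∀ n, ∀ x ∈ level A n, F (n + 1) x (g x) ∧ g x ∈ level A (n + 1)) ∧
      ∀ x, (∀ n, x ∉ A n) → g x = x := by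
  classical
  have hAmono : Monotone A := monotone_nat_of_le_succ hmono
  -- `γ k x` is an admissible target. One exists at level `n` because the part of the `F (n +
  -- 1)`-class in `A n` has positive size and is no larger than the part outside. Points in no `A n`
  -- stay fixed.
  let P : X → ℕ → Prop := fun x k =>
    (∃ n, x ∈ level A n ∧ F (n + 1) x (γ k x) ∧ γ k x ∉ A n) ∨ ((∀ n, x ∉ A n) ∧ γ k x = x)
  have hP : ∀ x, ∃ k, P x k := by
    intro x
    rcases exists_level_or A x with ⟨n, hn⟩ | hx
    · have hle := h.le n x (hmono n hn.1)
      have hpos : 0 < size ρ x ({y | F (n + 1) x y} ∩ A n) :=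
        size_pos hρ (E.refl x) ⟨(F (n + 1)).refl x, hn.1⟩
      have hne : ({y | F (n + 1) x y} \ A n).Nonempty := by
        by_contra hcon
        rw [not_nonempty_iff_eq_empty] at hcon
        rw [hcon, size_empty] at hle
        exact (hpos.trans_le hle).false
      obtain ⟨y, hy, hyA⟩ := hne
      obtain ⟨k, rfl⟩ := hγ.surj x y ((h.sub (n + 1)).le hy)
      exact ⟨k, .inl ⟨n, hn, hy, hyA⟩⟩
    · obtain ⟨k, hk⟩ := hγ.surj x x (E.refl x)
      exact ⟨k, .inr ⟨hx, hk⟩⟩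
  have hPm : ∀ k, MeasurableSet {x | P x k} := by
    intro k
    have : {x | P x k} = (⋃ n, level A n ∩ ({x | F (n + 1) x (γ k x)} ∩ γ k ⁻¹' (A n)ᶜ)) ∪
        ((⋂ n, (A n)ᶜ) ∩ {x | γ k x = x}) := by
      ext x
      simp [P]
    rw [this]
    refine MeasurableSet.union (.iUnion fun n => ?_) ?_
    · exact (measurableSet_level h.meas n).inter
        ((hγ.measurableSet_rel_right (h.sub (n + 1)).borel k).inter
          (hγ.meas k (h.meas n).compl))
    · exact (MeasurableSet.iInter fun n => (h.meas n).compl).inter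
        (measurableSet_eq_fun (hγ.meas k) measurable_id)
  have hfind := measurable_find hP hPm
  refine ⟨fun x => γ (Nat.find (hP x)) x, ?_, ?_, ?_⟩
  · intro T hT
    have : (fun x => γ (Nat.find (hP x)) x) ⁻¹' T =
        ⋃ k, {x | Nat.find (hP x) = k} ∩ γ k ⁻¹' T := by
      ext x
      simp
    rw [this]
    exact .iUnion fun k => (hfind (measurableSet_singleton k)).inter (hγ.meas k hT)
  · intro n x hx
    rcases Nat.find_spec (hP x) with ⟨m, hm, h1, h2⟩ | ⟨hno, -⟩
    · obtain rfl := level_unique hx hm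
      refine ⟨h1, h.inv (n + 1) x (hmono n hx.1) _ h1, fun k hk hkA => h2 ?_⟩
      exact hAmono (Nat.lt_succ_iff.1 hk) hkA
    · exact absurd hx.1 (hno n)
  · intro x hx
    rcases Nat.find_spec (hP x) with ⟨m, hm, -⟩ | ⟨-, hk⟩
    · exact absurd hm.1 (hx m)
    · exact hk

/-- The shift respects `levelRel` because `F n ≤ F (n + 1)`. Over a point of level `n + 1` the fiber
lies in the part of its `F (n + 1)`-class inside `A n`, which by `le` is no larger than the part
outside, and this part belongs to the `levelRel`-class of the point. Nothing is sent into `A 0`, and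
`A 0` meets every class, so the strict inequality occurs in every class. -/
theorem IsStageSequence.hasFiniteToOneQuotientCompression [StandardBorelSpace X]
    {γ : ℕ → X → X} (hγ : Generates E γ) (hρ : IsBorelCocycle E ρ) (h : IsStageSequence E ρ F A)
    (hmono : ∀ n, A n ⊆ A (n + 1)) (hcomp : IsComplete E (A 0)) :
    HasFiniteToOneQuotientCompression E ρ := by
  obtain ⟨g, hgm, hglev, hgid⟩ := h.exists_shift hγ hρ hmono
  have hG := h.isFiniteBorelSub_levelRel
  set G := levelRel F A with hGdef
  have hgE : ∀ x, E x (g x) := by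
    intro x
    rcases exists_level_or A x with ⟨n, hn⟩ | hx
    · exact (h.sub (n + 1)).le (hglev n x hn).1
    · rw [hgid x hx]
  have hgG : ∀ x y, G x y → G (g x) (g y) := by
    rintro x y (rfl | ⟨n, hx, hy, hxy⟩)
    · exact G.refl _
    · obtain ⟨h1, h2⟩ := hglev n x hx
      obtain ⟨h3, h4⟩ := hglev n y hy
      exact .inr ⟨n + 1, h2, h4, (F (n + 1)).trans ((F (n + 1)).symm h1)
        ((F (n + 1)).trans (h.mono n hxy) h3)⟩
  let φ : Quotient G → Quotient G := Quotient.map' g hgG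
  have hφ : ∀ x, φ (Quotient.mk G x) = Quotient.mk G (g x) := fun x => rfl
  have hfib : ∀ y, Quotient.mk G ⁻¹' (φ ⁻¹' {Quotient.mk G y}) = {x | G (g x) y} := by
    intro y
    ext x
    exact ⟨fun hx => Quotient.exact hx, fun hx => Quotient.sound hx⟩
  have hfib_zero : ∀ y ∈ A 0, {x | G (g x) y} = ∅ := by
    intro y hy
    rw [eq_empty_iff_forall_notMem]
    intro x hx
    rcases exists_level_or A x with ⟨n, hn⟩ | hxA
    · have hg := (hglev n x hn).2
      rcases hx with hxy | ⟨m, h1, h2, -⟩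
      · exact hg.2 0 (Nat.succ_pos n) (hxy ▸ hy)
      · obtain rfl := level_unique hg h1
        exact h2.2 0 (Nat.succ_pos n) hy
    · rcases hx with hxy | ⟨m, h1, -⟩
      · rw [hgid x hxA] at hxy
        exact hxA 0 (hxy ▸ hy)
      · rw [hgid x hxA] at h1
        exact hxA m h1.1
  have hfib_succ : ∀ n, ∀ y ∈ level A (n + 1), {x | G (g x) y} ⊆ {x | F (n + 1) y x} ∩ A n := by
    intro n y hy x hx
    rcases exists_level_or A x with ⟨m, hm⟩ | hxA
    · have hg := hglev m x hm
      have hF : m = n ∧ F (m + 1) (g x) y := by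
        rcases hx with rfl | ⟨k, h1, h2, h3⟩
        · exact ⟨Nat.succ_injective (level_unique hg.2 hy), (F (m + 1)).refl _⟩
        · obtain rfl := level_unique hg.2 h1
          exact ⟨Nat.succ_injective (level_unique h2 hy), h3⟩
      obtain ⟨rfl, hF⟩ := hF
      exact ⟨(F (m + 1)).symm ((F (m + 1)).trans hg.1 hF), hm.1⟩
    · rcases hx with hxy | ⟨m, h1, -⟩
      · rw [hgid x hxA] at hxy
        exact absurd (hxy ▸ hy.1) (hxA (n + 1))
      · rw [hgid x hxA] at h1
        exact absurd h1.1 (hxA m)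
  have hfib_out : ∀ y, (∀ n, y ∉ A n) → {x | G (g x) y} ⊆ {y} := by
    intro y hy x hx
    have hgxy : g x = y := by
      rcases hx with hxy | ⟨m, -, h2, -⟩
      · exact hxy
      · exact absurd h2.1 (hy m)
    rcases exists_level_or A x with ⟨m, hm⟩ | hxA
    · exact absurd (hgxy ▸ (hglev m x hm).2.1) (hy (m + 1))
    · rw [hgid x hxA] at hgxy
      exact hgxy
  have hcases : ∀ y, y ∈ A 0 ∨ (∃ n, y ∈ level A (n + 1)) ∨ ∀ n, y ∉ A n := by
    intro y
    rcases exists_level_or A y with ⟨_ | n, hn⟩ | hy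
    · exact .inl hn.1
    · exact .inr (.inl ⟨n, hn⟩)
    · exact .inr (.inr hy)
  have hsize : ∀ y, size (quotientCocycle G ρ) (Quotient.mk G y) (φ ⁻¹' {Quotient.mk G y}) =
      relSize ρ y {x | G (g x) y} {z | G y z} := by
    intro y
    rw [size_quotientCocycle hρ hG, hfib]
    intro x hx
    have : G (g x) y := Quotient.exact hx
    exact E.trans (hgE x) (hG.le this)
  refine ⟨G, hG, φ, ?_, ?_, ?_, ?_, ?_⟩
  · exact measurable_from_quotient.2 (measurable_quotient_mk''.comp hgm)
  · intro c
    induction c using Quotient.inductionOn with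
    | _ y =>
      have hfin : {x | G (g x) y}.Finite := by
        rcases hcases y with hy | ⟨n, hn⟩ | hy
        · rw [hfib_zero y hy]
          exact finite_empty
        · exact ((h.sub (n + 1)).finite_class y).subset
            ((hfib_succ n y hn).trans inter_subset_left)
        · exact (finite_singleton y).subset (hfib_out y hy)
      have hsurj : Function.Surjective (Quotient.mk G) := Quotient.mk_surjective
      rw [← hfib] at hfin
      rw [← image_preimage_eq (φ ⁻¹' {Quotient.mk G y}) hsurj]
      exact hfin.image _
  · intro c
    induction c using Quotient.inductionOn with
    | _ x => exact Quotient.sound (hgE x)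
  · intro c
    induction c using Quotient.inductionOn with
    | _ y =>
      rw [hsize]
      refine ENNReal.div_le_of_le_mul ?_
      rw [one_mul]
      rcases hcases y with hy | ⟨n, hn⟩ | hy
      · rw [hfib_zero y hy, size_empty]
        exact zero_le
      -- Since the `A k` increase, points of this class outside `A n` have level exactly `n + 1`.
      · refine (size_mono y (hfib_succ n y hn)).trans ((h.le n y hn.1).trans (size_mono y ?_))
        rintro z ⟨hz, hzA⟩
        refine .inr ⟨n + 1, hn, ⟨h.inv (n + 1) y hn.1 z hz, fun k hk hkA => hzA ?_⟩, hz⟩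
        exact monotone_nat_of_le_succ hmono (Nat.lt_succ_iff.1 hk) hkA
      · refine size_mono y ((hfib_out y hy).trans ?_)
        rintro z rfl
        exact G.refl z
  · intro c
    induction c using Quotient.inductionOn with
    | _ x =>
      obtain ⟨y, hy, hyx⟩ := hcomp x
      refine ⟨Quotient.mk G y, ?_, Quotient.sound hyx⟩
      show size _ _ _ < 1
      rw [hsize, hfib_zero y hy, relSize, size_empty, ENNReal.zero_div]
      exact one_pos

end

end BorelCocycle

/-! ### The decomposition. -/

theorem mainTheorem3 {X : Type*} [MeasurableSpace X] [StandardBorelSpace X]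
    (E : Setoid X) (hE : BorelCocycle.IsBorelRel E) (hEc : BorelCocycle.IsCountableRel E)
    (ρ : X → X → ℝ) (hρ : BorelCocycle.IsBorelCocycle E ρ)
    (A : Set X) (hA : MeasurableSet A) (hAc : BorelCocycle.IsComplete E A) :
    ∃ B C D : Set X,
      (MeasurableSet B ∧ BorelCocycle.IsInvariant E B ∧
        BorelCocycle.IsSmooth (BorelCocycle.restrictRel E B)
          (BorelCocycle.restrictCocycle ρ B)) ∧
      (MeasurableSet C ∧ BorelCocycle.IsInvariant E C ∧
        BorelCocycle.HasSigmaPositiveDensity (BorelCocycle.restrictRel E C)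
          (BorelCocycle.restrictCocycle ρ C) (Subtype.val ⁻¹' A : Set C)) ∧
      (MeasurableSet D ∧ BorelCocycle.IsInvariant E D ∧
        BorelCocycle.HasFiniteToOneQuotientCompression (BorelCocycle.restrictRel E D)
          (BorelCocycle.restrictCocycle ρ D)) ∧
      B ∪ C ∪ D = Set.univ := by
  obtain ⟨γ, hγ⟩ := BorelCocycle.exists_generates hE hEc
  obtain ⟨F, S, hst, hS0, hdense, hlac⟩ := hγ.exists_isStageSequence hρ hA
  have hSm := hst.meas
  have hrange : ∀ {Y : Set X}, BorelCocycle.IsInvariant E Y → ∀ x ∈ Set.range (Subtype.val : Y → X), ∀ y,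
      E x y → y ∈ Set.range (Subtype.val : Y → X) := by
    rintro Y hY x ⟨z, rfl⟩ y hxy
    exact ⟨⟨y, hY _ _ hxy z.2⟩, rfl⟩
  -- A class outside `D` has at some stage `n` a point of `S n` that is not in `S (n + 1)`. It lies
  -- in `C' n` if no point avoids both sets, and in `B' n` otherwise.
  let C' : ℕ → Set X := fun n => {x | ∀ y, E x y → y ∈ S n ∪ S (n + 1)}
  let B' : ℕ → Set X := fun n =>
    {x | (∃ y, E x y ∧ y ∈ S n ∧ y ∉ S (n + 1)) ∧ ∃ y, E x y ∧ y ∉ S n ∧ y ∉ S (n + 1)}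
  let D : Set X := {x | ∀ n, ∀ y, E x y → y ∈ (S n)ᶜ ∪ S (n + 1)}
  have hC'm : ∀ n, MeasurableSet (C' n) := fun n => hγ.measurableSet_forall fun k =>
    hγ.meas k ((hSm n).union (hSm (n + 1)))
  have hB'm : ∀ n, MeasurableSet (B' n) := fun n =>
    (hγ.measurableSet_exists (p := fun _ y => y ∈ S n ∧ y ∉ S (n + 1)) fun k =>
      hγ.meas k ((hSm n).inter (hSm (n + 1)).compl)).inter
    (hγ.measurableSet_exists (p := fun _ y => y ∉ S n ∧ y ∉ S (n + 1)) fun k =>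
      hγ.meas k ((hSm n).compl.inter (hSm (n + 1)).compl))
  have hDm : MeasurableSet D := by
    have : D = ⋂ n, {x | ∀ y, E x y → y ∈ (S n)ᶜ ∪ S (n + 1)} := by
      ext x; simp [D]
    rw [this]
    exact .iInter fun n => hγ.measurableSet_forall fun k =>
      hγ.meas k ((hSm n).compl.union (hSm (n + 1)))
  have hC'i : ∀ n, BorelCocycle.IsInvariant E (C' n) := fun n x y hxy hx z hyz => hx z (E.trans hxy hyz)
  have hDi : BorelCocycle.IsInvariant E D := fun x y hxy hx n z hyz => hx n z (E.trans hxy hyz)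
  have hB'i : ∀ n, BorelCocycle.IsInvariant E (B' n) := by
    rintro n x y hxy ⟨⟨z, hz, hz'⟩, w, hw, hw'⟩
    exact ⟨⟨z, E.trans (E.symm hxy) hz, hz'⟩, w, E.trans (E.symm hxy) hw, hw'⟩
  have hUi : ∀ {V : ℕ → Set X}, (∀ n, BorelCocycle.IsInvariant E (V n)) → BorelCocycle.IsInvariant E (⋃ n, V n) := by
    intro V hV x y hxy hx
    obtain ⟨n, hn⟩ := Set.mem_iUnion.1 hx
    exact Set.mem_iUnion.2 ⟨n, hV n x y hxy hn⟩
  refine ⟨⋃ n, B' n, ⋃ n, C' n, D, ⟨.iUnion hB'm, hUi hB'i, ?_⟩, ⟨.iUnion hC'm, hUi hC'i, ?_⟩,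
    ⟨hDm, hDi, ?_⟩, ?_⟩
  · exact (BorelCocycle.CountablyLacunary.iUnion hlac).isSmooth
  · refine ⟨fun n => Subtype.val ⁻¹' C' n, fun n => ⟨measurable_subtype_coe (hC'm n),
      fun x y hxy hx => hC'i n _ _ hxy hx⟩, ?_, fun n => ?_⟩
    · rw [Set.eq_univ_iff_forall]
      intro x
      obtain ⟨n, hn⟩ := Set.mem_iUnion.1 x.2
      exact Set.mem_iUnion.2 ⟨n, hn⟩
    · let f : (Subtype.val ⁻¹' C' n : Set (⋃ n, C' n : Set X)) → X := fun x => x.1.1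
      have hfr : Set.range f = C' n := by
        ext x
        constructor
        · rintro ⟨y, rfl⟩
          exact y.2
        · exact fun hx => ⟨⟨⟨x, Set.mem_iUnion.2 ⟨n, hx⟩⟩, hx⟩, rfl⟩
      have hd : BorelCocycle.IsDenseIn ρ (F (n + 1)) A (Set.range f) ((4 ^ (n + 1) : ℕ) : ℝ≥0∞) := by
        intro x hx
        rw [hfr] at hx
        push_cast
        -- Off `S (n + 1)` the `F (n + 1)`-class is still the `F n`-class, and the point is in `S
        -- n`, so the smaller constant `4 ^ n` is available.
        by_cases hxS : x ∈ S (n + 1)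
        · exact hdense (n + 1) x hxS
        · have hxn : x ∈ S n := (hx x (E.refl x)).resolve_right hxS
          have hcls : {y | F (n + 1) x y} = {y | F n x y} := by
            ext y
            exact ⟨fun h => hst.out n x hxS y h, fun h => hst.mono n h⟩
          rw [hcls]
          refine (hdense n x hxn).trans (mul_le_mul_left ?_ _)
          exact pow_le_pow_right₀ (by norm_num) (Nat.le_succ n)
      exact BorelCocycle.hasPositiveDensity_of_isDenseIn hρ
        (measurable_subtype_coe.comp measurable_subtype_coe)
        (Subtype.val_injective.comp Subtype.val_injective)
        (fun x hx y hxy => by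
          change y ∈ Set.range f
          change x ∈ Set.range f at hx
          rw [hfr] at hx ⊢
          exact hC'i n x y hxy hx) (hst.sub (n + 1)) (by positivity) hd
  -- On `D` the sets `S n` increase, as the compression requires; the involutions are chosen anew
  -- for the restricted relation.
  · have : StandardBorelSpace D := hDm.standardBorel
    have hsub := hst.comap (f := (Subtype.val : D → X)) measurable_subtype_coe
      Subtype.val_injective (hrange hDi)
    have hρD := hρ.comap (f := (Subtype.val : D → X)) measurable_subtype_coe
    obtain ⟨γ', hγ'⟩ := BorelCocycle.exists_generates (E := E.comap (Subtype.val : D → X))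
      (((measurable_subtype_coe.comp measurable_fst).prodMk
        (measurable_subtype_coe.comp measurable_snd)) hE)
      fun x => (hEc x.1).preimage Subtype.val_injective
    refine hsub.hasFiniteToOneQuotientCompression hγ' hρD ?_ ?_
    · intro n x hx
      exact (x.2 n x.1 (E.refl _)).resolve_left (not_not_intro hx)
    · intro x
      obtain ⟨y, hy, hyx⟩ := hAc x.1
      exact ⟨⟨y, hDi _ _ (E.symm hyx) x.2⟩, by rw [hS0]; exact hy, hyx⟩
  · rw [Set.eq_univ_iff_forall]
    intro x
    by_cases hD : x ∈ D
    · exact .inr hD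
    left
    simp only [D, Set.mem_ofPred_eq, not_forall] at hD
    obtain ⟨n, y, hxy, hy⟩ := hD
    simp only [Set.mem_union, Set.mem_compl_iff, not_or, not_not] at hy
    by_cases hC : x ∈ C' n
    · exact .inr (Set.mem_iUnion.2 ⟨n, hC⟩)
    left
    simp only [C', Set.mem_ofPred_eq, not_forall] at hC
    obtain ⟨z, hxz, hz⟩ := hC
    simp only [Set.mem_union, not_or] at hz
    exact Set.mem_iUnion.2 ⟨n, ⟨y, hxy, hy⟩, z, hxz, hz⟩
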